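/- **Setting.** A *plumbing graph* $\Gamma$ is a finite forest with integer weights on its vertices; write $|\Gamma|$ for its number of vertices. Its intersection form on $H_2=\mathbb Z^{V(\Gamma)}$ has $v^2$ equal to the weight of $v$ and $v\cdot w=1$ or $0$ according to whether $v\ne w$ are adjacent. Suppose that it is negative definite. Let $\mathrm{Char}(\Gamma)$ be the set of $K\in \mathrm{Hom}(H_2,\mathbb Z)$ with $K(v)\equiv v^2 \pmod 2$ for all vertices $v$. A class $x$ acts by $K+x:=K+2\,\mathrm{PD}[x]$. The $\mathrm{Spin}^c$ structures $\mathfrak t$ on the boundary $Y_\Gamma$ are the $H_2$-orbits in $\mathrm{Char}(\Gamma)$. For $E\subseteq V(\Gamma)$ the cube $[K,E]$ has vertices $K+\sum_{v\in I}v$, $I\subseteq E$. Put $h_U(K)=\frac{K^2+|\Gamma|}{4}$, and let $h_U([K,E])$ be the minimum of $h_U$ over the vertices of $[K,E]$. Let $\mathrm{gr}(\mathfrak t)\in\mathbb Q/2\mathbb Z$ be the class of $h_U(K)$, $K\in\mathfrak t$. Let $D_{\Gamma,\mathfrak t}$ be the category of cubes over $\mathfrak t$, with one morphism from each cube to each of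 its faces (itself included). A (doubly) filtered simplicial set is a simplicial set with one (two) rational height function(s) on its simplices that do not decrease on passing to faces; filtered maps do not decrease heights. Homotopy colimits are formed by simplicial replacement: an $m$-simplex of $\operatorname{hocolim}F$ is a chain $c_0\to\dots\to c_m$ with an $m$-simplex of $F(c_0)$, and has the height(s) of the latter. The lattice space $\mathbb{CF}^\natural(\Gamma,\mathfrak t)$ is the homotopy colimit over $D_{\Gamma,\mathfrak t}$ of points of heights $h_U([K,E])$. Let $G_{v_0}$ be a forest with integer weights on all vertices except $v_0$, and $G=G_{v_0}\smallsetminus v_0$ negative definite. The vertex $v_0$ acts on $\mathrm{Char}(G)$ by $K\mapsto K+v_0=K+2\,\mathrm{PD}[v_0]$, hence on $\mathrm{Spin}^c(Y_G)$ by $\mathfrak t\mapsto\mathfrak t+v_0$. An object of $\mathcal C^\Gamma_{G_{v_0}}$ (doubly filtered spaces with flip map) is a family of doubly filtered simplicial sets $X^{\mathfrak t}$, $\mathfrak t\in\mathrm{Spin}^c(Y_G)$, with heights $h_1\in\mathrm{gr}(\mathfrak t)$ and $h_2\in\mathrm{gr}(\mathfrak t+v_0)$, and simplicial maps $\Gamma^{\mathfrak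 t}\colon X^{\mathfrak t}\to X^{\mathfrak t+v_0}$ with $h_2(x)\le h_1(\Gamma^{\mathfrak t}x)$; morphisms are families of doubly filtered maps commuting with the flip maps. The knot lattice space $\mathbb{CFK}^\natural(G_{v_0})\in\mathcal C^\Gamma_{G_{v_0}}$ is at $\mathfrak t$ the homotopy colimit over $D_{G,\mathfrak t}$ of points of heights $(h_U,h_V)$, $h_V([K,E])=h_U([K+v_0,E])$, with $\Gamma$ induced by $[K,E]\mapsto[K+v_0,E]$. **Surgery.** Let $G_{v_0}(n)$ be $G_{v_0}$ with weight $n$ on $v_0$, where $n$ is such that $G_{v_0}(n)$ is negative definite, and let $G_{v_0}(n)_{u_0}$ be $G_{v_0}(n)$ with a new unweighted vertex $u_0$ adjacent only to $v_0$ (it represents the dual knot). Let $\Sigma_0\in H_2(X_G;\mathbb Q)$ satisfy $\mathrm{PD}[\Sigma_0]=\mathrm{PD}[v_0]$ on $G$, and put $\Sigma=v_0-\Sigma_0$, so $\Sigma^2=n-\Sigma_0^2<0$. For $L\in\mathrm{Char}(G_{v_0}(n))$ put $\hat A(L)=\frac{L(\Sigma)+\Sigma^2}{2}$, and put $\mathrm{gr}_{\Sigma^2}(i)=\frac{(2i-\Sigma^2)^2+\Sigma^2}{4\Sigma^2}$.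 For $\mathfrak q\in\mathrm{Spin}^c(Y_{G_{v_0}(n)})$ let $\mathcal I_{\mathfrak q}$ be the category with objects $(\mathfrak t,i,a)$ and $(\mathfrak t,i,b)$ for all pairs $(\mathfrak t,i)=([L|_G],\hat A(L))$ with $L\in\mathfrak q$, and non-identity morphisms $\lambda\colon(\mathfrak t,i,a)\to(\mathfrak t,i,b)$ and $\rho\colon(\mathfrak t,i,a)\to(\mathfrak t+v_0,i+\Sigma^2,b)$. For $X\in\mathcal C^\Gamma_{G_{v_0}}$ let $\mathrm{XD}^{\mathfrak q}(X)\colon \mathcal I_{\mathfrak q}\to$ (filtered simplicial sets) send $(\mathfrak t,i,a)$ to $A_{\mathfrak t,i}$, i.e. $X^{\mathfrak t}$ with height $\min(h_1,h_2+2i)+\mathrm{gr}_{\Sigma^2}(i)$, and $(\mathfrak t,i,b)$ to $B_{\mathfrak t,i}$, i.e. $X^{\mathfrak t}$ with height $h_1+\mathrm{gr}_{\Sigma^2}(i)$; $\lambda$ goes to the identity and $\rho$ to $\Gamma^{\mathfrak t}$ on underlying simplicial sets. Let $\mathrm{XKD}^{\mathfrak q}(X)$ be the same diagram of simplicial sets,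 doubly filtered by the heights of $A_{\mathfrak t,i},A_{\mathfrak t,i+1}$, respectively $B_{\mathfrak t,i},B_{\mathfrak t,i+1}$. Then $\mathbb{XK}_{\Sigma^2}(X)\in\mathcal C^\Gamma_{G_{v_0}(n)_{u_0}}$ is $\operatorname{hocolim}\mathrm{XKD}^{\mathfrak q}(X)$ at $\mathfrak q$, with the flip map to the entry at $\mathfrak q+u_0$ induced by the shift $i\mapsto i+1$ of index categories and the identity of the spaces. For an object $j$ of $\mathcal I_{\mathfrak q}$ over $(\mathfrak t,i)$, let $P_j$ be the homotopy colimit of points of heights $h_U([L,E])$ over the cubes $[L,E]$ in $D_{G_{v_0}(n),\mathfrak q}$ with $[L|_G]=\mathfrak t$, $\hat A(L)=i$, and $v_0\in E$ if $j=(\mathfrak t,i,a)$, $v_0\notin E$ if $j=(\mathfrak t,i,b)$. The $P_j$ form a diagram $P^{\mathfrak q}$ on $\mathcal I_{\mathfrak q}$ ($\lambda$ and $\rho$ act by $[L,E]\mapsto[L,E\smallsetminus v_0]$ and $[L,E]\mapsto[L+v_0,E\smallsetminus v_0]$). There is a canonical filtered map $\operatorname{hocolim}P^{\mathfrak q}\to\mathbb{CF}^\natural(G_{v_0}(n),\mathfrak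 q)$, sending a chain $j_0\to\dots\to j_m$ and a chain of cubes $c_0\to\dots\to c_m$ of $P_{j_0}$ to the chain whose $k$-th cube is the image of $c_k$ under $j_0\to j_k$. **Proposition.** The canonical maps $\operatorname{hocolim}P^{\mathfrak q}\to\mathbb{CF}^\natural(G_{v_0}(n),\mathfrak q)$ are isomorphisms of filtered simplicial sets, and the maps $[L,E]\mapsto[L|_G,E\smallsetminus\{v_0\}]$ induce isomorphisms of diagrams of filtered simplicial sets $\Phi^{\mathfrak q}\colon P^{\mathfrak q}\cong\mathrm{XD}^{\mathfrak q}(\mathbb{CFK}^\natural(G_{v_0}))$. The resulting isomorphisms $$\operatorname{hocolim}\Phi^{\mathfrak q}\colon\ \mathbb{CF}^\natural(G_{v_0}(n),\mathfrak q)\ \cong\ \operatorname{hocolim}\mathrm{XD}^{\mathfrak q}(\mathbb{CFK}^\natural(G_{v_0}))$$ extend to an isomorphism of doubly filtered spaces with flip map $$\mathbb{CFK}^\natural(G_{v_0}(n)_{u_0})\ \cong\ \mathbb{XK}_{\Sigma^2}(\mathbb{CFK}^\natural(G_{v_0}))$$ in $\mathcal C^\Gamma_{G_{v_0}(n)_{u_0}}$: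 there is an isomorphism in this category whose first-filtered component at every $\mathfrak q$ is $\operatorname{hocolim}\Phi^{\mathfrak q}$. -/

import Mathlib

open CategoryTheory
open scoped Matrix

universe u

set_option linter.unusedSectionVars false

namespace KnotLattice

/-! ### Filtered simplicial sets and homotopy colimits -/

/-- A simplicial set filtered by the poset `P` through a height function: the level at `p` is the
simplicial subset of the simplices of height at least `p`.  The height of a face is at least the
height of the simplex.  A doubly filtered simplicial set has `P = ℚ × ℚ`. -/
structure FiltSSet (P : Type) [Preorder P] where
  space : SSet.{u}
  height : ∀ {n : SimplexCategoryᵒᵖ}, space.obj n → P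
  height_le : ∀ {m n : SimplexCategoryᵒᵖ} (f : m ⟶ n) (x : space.obj m),
    height x ≤ height (space.map f x)

namespace FiltSSet

section
variable {P : Type} [Preorder P]

/-- A filtered map: a map of simplicial sets which does not decrease the height. -/
structure Hom (X Y : FiltSSet.{u} P) where
  base : X.space ⟶ Y.space
  mono : ∀ {n : SimplexCategoryᵒᵖ} (x : X.space.obj n), X.height x ≤ Y.height (base.app n x)

instance : Category (FiltSSet.{u} P) where
  Hom := Hom
  id X := { base := 𝟙 X.space, mono := fun _ => le_rfl }
  comp f g := { base := f.base ≫ g.base, mono := fun x => (f.mono x).trans (g.mono _) }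

@[ext]
theorem hom_ext {X Y : FiltSSet.{u} P} (f g : X ⟶ Y) (h : f.base = g.base) : f = g := by
  change Hom X Y at f g
  cases f; cases g; cases h; rfl

@[simp] theorem id_base (X : FiltSSet.{u} P) : Hom.base (𝟙 X) = 𝟙 X.space := rfl
@[simp] theorem comp_base {X Y Z : FiltSSet.{u} P} (f : X ⟶ Y) (g : Y ⟶ Z) :
    (f ≫ g).base = f.base ≫ g.base := rfl

/-- The underlying simplicial set. -/
def forget : FiltSSet.{u} P ⥤ SSet.{u} where
  obj X := X.space
  map f := f.base

end

/-- The change of filtration along a monotone map `φ`: the same simplicial set, with `φ` applied to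
the height. -/
def reindex {P R : Type} [Preorder P] [Preorder R] (φ : P →o R) :
    FiltSSet.{u} P ⥤ FiltSSet.{u} R where
  obj X :=
    { space := X.space
      height := fun x => φ (X.height x)
      height_le := fun f x => φ.monotone (X.height_le f x) }
  map {X Y} (f : Hom X Y) :=
    { base := f.base
      mono := fun x => φ.monotone (f.mono x) }

end FiltSSet

section
variable {J : Type u} [SmallCategory J]

theorem map_self_app (F : J ⥤ SSet.{u}) {k : ℕ} (c : ComposableArrows J k) (i : Fin (k + 1))
    (h : i ⟶ i) (n : SimplexCategoryᵒᵖ) (x : (F.obj (c.obj i)).obj n) :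
    (F.map (c.map h)).app n x = x := by
  have : h = 𝟙 i := Subsingleton.elim _ _
  subst this
  rw [c.map_id, F.map_id]
  rfl

theorem map_trans_app (F : J ⥤ SSet.{u}) {k : ℕ} (c : ComposableArrows J k) {i j l : Fin (k + 1)}
    (a : i ⟶ j) (b : j ⟶ l) (d : i ⟶ l) {m n : SimplexCategoryᵒᵖ} (g : m ⟶ n)
    (x : (F.obj (c.obj i)).obj m) :
    (F.map (c.map b)).app n ((F.obj (c.obj j)).map g ((F.map (c.map a)).app m x)) =
      (F.map (c.map d)).app n ((F.obj (c.obj i)).map g x) := by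
  have : d = a ≫ b := Subsingleton.elim _ _
  subst this
  rw [← NatTrans.naturality_apply, c.map_comp, F.map_comp]
  rfl

/-- The homotopy colimit of a diagram of simplicial sets (simplicial replacement): an `n`-simplex is
a chain `c₀ ⟶ ⋯ ⟶ cₙ` of the index category together with an `n`-simplex of `F c₀`. -/
def hocolimSpace (F : J ⥤ SSet.{u}) : SSet.{u} where
  obj n := Σ c : (nerve J).obj n, (F.obj (c.obj 0)).obj n
  map {m n} f := ↾fun x =>
    ⟨(nerve J).map f x.1,
      (F.map (x.1.map (homOfLE (Fin.zero_le (f.unop.toOrderHom 0))))).app n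
        ((F.obj (x.1.obj 0)).map f x.2)⟩
  map_id n := by
    ext x
    · rfl
    · apply heq_of_eq
      obtain ⟨c, x⟩ := x
      refine (map_self_app F c 0 _ n _).trans ?_
      rw [(F.obj (c.obj 0)).map_id]
      rfl
  map_comp {l m n} f g := by
    ext x
    · rfl
    · apply heq_of_eq
      obtain ⟨c, x⟩ := x
      refine Eq.trans ?_ (map_trans_app F c (homOfLE (Fin.zero_le (f.unop.toOrderHom 0)))
        (homOfLE (f.unop.toOrderHom.monotone (Fin.zero_le (g.unop.toOrderHom 0)))) 
        (homOfLE (Fin.zero_le _)) g ((F.obj (c.obj 0)).map f x)).symm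
      rw [← comp_apply ((F.obj (c.obj 0)).map f), ← (F.obj (c.obj 0)).map_comp]
      rfl

theorem natTrans_map_app {J' : Type u} [SmallCategory J'] {F : J ⥤ SSet.{u}} {F' : J' ⥤ SSet.{u}}
    (S : J ⥤ J') (α : F ⟶ S ⋙ F') {i j : J} (a : i ⟶ j) {m n : SimplexCategoryᵒᵖ} (f : m ⟶ n)
    (x : (F.obj i).obj m) :
    (α.app j).app n ((F.map a).app n ((F.obj i).map f x)) =
      (F'.map (S.map a)).app n ((F'.obj (S.obj i)).map f ((α.app i).app m x)) := by
  have h := NatTrans.naturality_apply (α.app i) f x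
  refine Eq.trans ?_ (congrArg ((F'.map (S.map a)).app n) h)
  exact congrArg (fun t => t.app n ((F.obj i).map f x)) (α.naturality a)

/-- The map of homotopy colimits induced by a functor of index categories and a natural
transformation. -/
def hocolimSpaceMap {J' : Type u} [SmallCategory J'] {F : J ⥤ SSet.{u}} {F' : J' ⥤ SSet.{u}}
    (S : J ⥤ J') (α : F ⟶ S ⋙ F') : hocolimSpace F ⟶ hocolimSpace F' where
  app n := ↾fun x => ⟨(nerveMap S).app n x.1, (α.app (x.1.obj 0)).app n x.2⟩
  naturality m n f := by
    apply ConcreteCategory.hom_ext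
    rintro ⟨c, x⟩
    exact Sigma.ext rfl (heq_of_eq (natTrans_map_app S α _ f x))

open FiltSSet

/-- The homotopy colimit of a diagram of filtered simplicial sets.  It is formed level by level, so
the height of the simplex `(c₀ ⟶ ⋯ ⟶ cₙ, x)` is the height of `x` in `F c₀`. -/
def hocolim {P : Type} [Preorder P] (F : J ⥤ FiltSSet.{u} P) : FiltSSet.{u} P where
  space := hocolimSpace (F ⋙ forget)
  height x := (F.obj (x.1.obj 0)).height x.2
  height_le f x :=
    ((F.obj (x.1.obj 0)).height_le f x.2).trans
      ((F.map (x.1.map (homOfLE (Fin.zero_le (f.unop.toOrderHom 0))))).mono _)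

/-- Functoriality of `hocolim` in the index category and the diagram. -/
def hocolimMap {P : Type} [Preorder P] {J' : Type u} [SmallCategory J'] {F : J ⥤ FiltSSet.{u} P}
    {F' : J' ⥤ FiltSSet.{u} P}
    (S : J ⥤ J') (α : F ⟶ S ⋙ F') : hocolim F ⟶ hocolim F' where
  base := hocolimSpaceMap S (Functor.whiskerRight α forget)
  mono x := (α.app (x.1.obj 0)).mono x.2


/-- The map `hocolim α` induced by a natural transformation `α`. -/
def hocolimNat {P : Type} [Preorder P] {F F' : J ⥤ FiltSSet.{u} P} (α : F ⟶ F') :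
    hocolim F ⟶ hocolim F' :=
  hocolimMap (𝟭 J) (F' := F') α

/-- The diagram of one-point spaces on a poset `J` (as a category, `j ⟶ j'` for `j ≤ j'`), the
point at `j` having height `h j`. -/
def points {J : Type u} [Preorder J] {P : Type} [Preorder P] (h : J →o P) :
    J ⥤ FiltSSet.{u} P where
  obj j :=
    { space := (Functor.const _).obj PUnit.{u + 1}
      height := fun _ => h j
      height_le := fun _ _ => le_rfl }
  map f :=
    { base := 𝟙 _
      mono := fun _ => h.monotone (leOfHom f) }

/-- The map of homotopy colimits of diagrams of points induced by a monotone map of posets. -/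
def pointsMap {J J' : Type u} [Preorder J] [Preorder J'] {P : Type} [Preorder P] {h : J →o P}
    {h' : J' →o P} (f : J →o J') (hf : ∀ j, h j ≤ h' (f j)) :
    hocolim (points h) ⟶ hocolim (points h') :=
  hocolimMap f.monotone.functor
    { app := fun j => { base := 𝟙 _, mono := fun _ => hf j } }

theorem pointsMap_id {J : Type u} [Preorder J] {P : Type} [Preorder P] {h : J →o P} :
    pointsMap (h := h) OrderHom.id (fun _ => le_rfl) = 𝟙 (hocolim (points h)) := rfl

theorem pointsMap_comp {J J' J'' : Type u} [Preorder J] [Preorder J'] [Preorder J''] {P : Type}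
    [Preorder P] {h : J →o P} {h' : J' →o P} {h'' : J'' →o P} (f : J →o J') (g : J' →o J'')
    (hf : ∀ j, h j ≤ h' (f j)) (hg : ∀ j, h' j ≤ h'' (g j)) (hfg : ∀ j, h j ≤ h'' (g (f j))) :
    pointsMap (h := h) (h' := h'') (g.comp f) hfg = pointsMap f hf ≫ pointsMap g hg := rfl

end

/-! ### Plumbing graphs -/

/-- A graph with integer weights on the vertices, thought of as a plumbing graph. -/
structure WeightedGraph (V : Type u) where
  graph : SimpleGraph V
  weight : V → ℤ

namespace WeightedGraph

variable {V : Type u} (G : WeightedGraph V)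

/-- Characteristic classes: integral functions `K` on the vertices with `K v ≡ v²` modulo 2. -/
abbrev Char : Type u := {K : V → ℤ // ∀ v, K v ≡ G.weight v [ZMOD 2]}

variable [DecidableEq V]

open scoped Classical in
/-- The intersection form of the plumbed four-manifold in the basis of the vertices. -/
noncomputable def form : Matrix V V ℤ :=
  Matrix.of fun v w => if v = w then G.weight v else if G.graph.Adj v w then 1 else 0

/-- The intersection form over `ℚ`. -/
noncomputable def formQ : Matrix V V ℚ := G.form.map (fun k : ℤ => (k : ℚ))

variable [Fintype V]

/-- The intersection form is negative definite. -/
def NegDef : Prop := ∀ x : V → ℚ, x ≠ 0 → x ⬝ᵥ (G.formQ *ᵥ x) < 0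

variable {G}

namespace Char

/-- The action `K + [S] = K + 2 PD[S]` of the second homology `V → ℤ`. -/
noncomputable def add (K : G.Char) (x : V → ℤ) : G.Char :=
  ⟨fun v => K.1 v + 2 * (G.form *ᵥ x) v, fun v => by
    have h := K.2 v
    unfold Int.ModEq at h ⊢
    dsimp only
    omega⟩

/-- `K` as a rational vector. -/
def toRat (K : G.Char) : V → ℚ := fun v => (K.1 v : ℚ)

/-- The rational square `K²`. -/
noncomputable def sq (K : G.Char) : ℚ := K.toRat ⬝ᵥ (G.formQ⁻¹ *ᵥ K.toRat)

/-- The height `(K² + |V|) / 4` of a characteristic class. -/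
noncomputable def height (K : G.Char) : ℚ := (K.sq + Fintype.card V) / 4

theorem add_zero (K : G.Char) : K.add 0 = K := by
  apply Subtype.ext; funext v; simp [add]

theorem add_add (K : G.Char) (x y : V → ℤ) : (K.add x).add y = K.add (x + y) := by
  apply Subtype.ext; funext v; simp [add, Matrix.mulVec_add]; ring

end Char

variable (G) in
/-- Two characteristic classes are equivalent if they differ by the action of second homology. -/
instance spincSetoid : Setoid G.Char where
  r K K' := ∃ x : V → ℤ, K' = K.add x
  iseqv :=
    { refl := fun K => ⟨0, K.add_zero.symm⟩
      symm := by
        rintro K _ ⟨x, rfl⟩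
        exact ⟨-x, by rw [Char.add_add, add_neg_cancel, Char.add_zero]⟩
      trans := by
        rintro K _ _ ⟨x, rfl⟩ ⟨y, rfl⟩
        exact ⟨x + y, by rw [Char.add_add]⟩ }

variable (G) in
/-- Spin-c structures on the boundary of the plumbing: orbits of characteristic classes. -/
def Spinc : Type u := Quotient G.spincSetoid

/-- The spin-c structure on the boundary induced by a characteristic class. -/
noncomputable def Char.spinc (K : G.Char) : G.Spinc := Quotient.mk G.spincSetoid K

theorem Char.spinc_eq_iff {K K' : G.Char} : K.spinc = K'.spinc ↔ ∃ x : V → ℤ, K' = K.add x :=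
  Quotient.eq (r := G.spincSetoid)

@[simp] theorem Char.spinc_add (K : G.Char) (x : V → ℤ) : (K.add x).spinc = K.spinc :=
  (Char.spinc_eq_iff.2 ⟨x, rfl⟩).symm

/-- The coset `gr(Y, t)` of `2ℤ` in `ℚ`: the classes modulo `2ℤ` of the heights `(K² + |V|) / 4`
of the characteristic classes `K` inducing `t`. -/
def gradingCoset (t : G.Spinc) : Set ℚ :=
  {q | ∃ K : G.Char, K.spinc = t ∧ ∃ m : ℤ, q = K.height + 2 * m}

variable (G) in
/-- The cube `[K, E]`, with vertices `K + ∑_{v ∈ I} v` for `I ⊆ E`. -/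
@[ext]
structure Cube where
  char : G.Char
  dirs : Finset V

/-- The class `∑_{v ∈ I} v` in second homology. -/
def ind (I : Finset V) : V → ℤ := fun v => if v ∈ I then 1 else 0

theorem ind_union {I J : Finset V} (h : Disjoint I J) : ind (I ∪ J) = ind I + ind J := by
  funext v
  have : v ∈ I → v ∉ J := fun hv => Finset.disjoint_left.1 h hv
  by_cases h1 : v ∈ I <;> by_cases h2 : v ∈ J <;> simp_all [ind]

namespace Cube

/-- The face poset: `c ≤ c'` when `c'` is a face of `c`.  As a category there is a morphism
`c ⟶ c'` exactly when `c'` is a face of `c` (possibly `c` itself). -/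
noncomputable instance : Preorder G.Cube where
  le c c' := c'.dirs ⊆ c.dirs ∧ ∃ J ⊆ c.dirs \ c'.dirs, c'.char = c.char.add (ind J)
  le_refl c := ⟨subset_rfl, ∅, by simp, by
    rw [show ind (∅ : Finset V) = 0 by funext v; simp [ind], Char.add_zero]⟩
  le_trans := by
    rintro c c' c'' ⟨h, J, hJ, e⟩ ⟨h', J', hJ', e'⟩
    refine ⟨h'.trans h, J ∪ J', ?_, ?_⟩
    · intro v hv
      have a := @hJ v
      have b := @hJ' v
      have d := @h v
      have d' := @h' v
      simp only [Finset.mem_union, Finset.mem_sdiff] at *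
      tauto
    · have hd : Disjoint J J' := by
        rw [Finset.disjoint_left]
        intro v hv hv'
        exact (Finset.mem_sdiff.1 (hJ hv)).2 (Finset.mem_sdiff.1 (hJ' hv')).1
      rw [e', e, Char.add_add, ind_union hd]

theorem le_def {c c' : G.Cube} : c ≤ c' ↔
    c'.dirs ⊆ c.dirs ∧ ∃ J ⊆ c.dirs \ c'.dirs, c'.char = c.char.add (ind J) := Iff.rfl

/-- The height `h_U` of a cube: the minimum of the heights of its vertices. -/
noncomputable def height (c : G.Cube) : ℚ :=
  c.dirs.powerset.inf' ⟨∅, Finset.empty_mem_powerset _⟩ fun I => (c.char.add (ind I)).height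

theorem height_mono : Monotone (height : G.Cube → ℚ) := by
  rintro c c' ⟨h, J, hJ, e⟩
  refine Finset.le_inf' _ _ fun I hI => ?_
  have hI := Finset.mem_powerset.1 hI
  have hd : Disjoint J I := by
    rw [Finset.disjoint_left]
    intro v hv hv'
    exact (Finset.mem_sdiff.1 (hJ hv)).2 (hI hv')
  rw [e, Char.add_add, ← ind_union hd]
  refine Finset.inf'_le (fun I => (c.char.add (ind I)).height) (Finset.mem_powerset.2 ?_)
  exact Finset.union_subset (hJ.trans Finset.sdiff_subset) (hI.trans h)

theorem exists_height_eq (c : G.Cube) :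
    ∃ I ⊆ c.dirs, c.height = (c.char.add (ind I)).height := by
  obtain ⟨I, hI, e⟩ := Finset.exists_mem_eq_inf' (s := c.dirs.powerset)
    ⟨∅, Finset.empty_mem_powerset _⟩ (fun I => (c.char.add (ind I)).height)
  exact ⟨I, Finset.mem_powerset.1 hI, e⟩

theorem height_mem (c : G.Cube) : c.height ∈ gradingCoset c.char.spinc := by
  obtain ⟨I, -, e⟩ := c.exists_height_eq
  exact ⟨c.char.add (ind I), Char.spinc_add _ _, 0, by rw [e]; simp⟩

end Cube

variable (G) in
/-- The cubes over the spin-c structure `t`. -/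
abbrev CubeOver (t : G.Spinc) : Type u := {c : G.Cube // c.char.spinc = t}

/-- The height `h_U` as a monotone function. -/
noncomputable def CubeOver.height (t : G.Spinc) : G.CubeOver t →o ℚ where
  toFun c := c.1.height
  monotone' _ _ h := Cube.height_mono h

variable (G) in
/-- The lattice space of the plumbing at `t`: the homotopy colimit, over the category of cubes, of
points with heights `h_U`. -/
noncomputable def lattice (t : G.Spinc) : FiltSSet.{u} ℚ := hocolim (points (CubeOver.height t))

end WeightedGraph

/-! ### Knots in plumbings -/

/-- A weighted graph `G` together with one more, unweighted vertex `v₀`, whose set of neighbours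
in `G` is `nbr`. -/
structure KnotGraph (V : Type u) extends WeightedGraph V where
  nbr : Set V

namespace KnotGraph

variable {V : Type u} (G : KnotGraph V)

/-- The underlying graph including the unweighted vertex `v₀ = none`. -/
def total : SimpleGraph (Option V) where
  Adj x y := match x, y with
    | none, none => False
    | none, some w => w ∈ G.nbr
    | some v, none => v ∈ G.nbr
    | some v, some w => G.graph.Adj v w
  symm := ⟨by
    rintro (_ | v) (_ | w) h
    · exact h
    · exact h
    · exact h
    · exact SimpleGraph.Adj.symm h⟩
  loopless := ⟨by
    rintro (_ | v) h
    · exact h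
    · exact G.graph.irrefl h⟩

/-- The weighted graph obtained by giving `v₀` the weight `n`. -/
def fill (n : ℤ) : WeightedGraph (Option V) where
  graph := G.total
  weight x := x.elim n G.weight

/-- The weighted graph `G.fill n` with a new unweighted vertex `u₀`, adjacent to `v₀` only.  Its
knot is the dual knot of the surgery. -/
abbrev dual (n : ℤ) : KnotGraph (Option V) where
  toWeightedGraph := G.fill n
  nbr := {none}

open scoped Classical in
/-- The intersection numbers of `v₀` with the vertices of `G`. -/
noncomputable def link : V → ℤ := fun v => if v ∈ G.nbr then 1 else 0

variable {G}

/-- The action `K + v₀ = K + 2 PD[v₀]` of the unweighted vertex. -/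
noncomputable def addKnotChar (K : G.Char) : G.Char :=
  ⟨fun v => K.1 v + 2 * G.link v, fun v => by
    have h := K.2 v
    unfold Int.ModEq at h ⊢
    dsimp only
    omega⟩

variable [Fintype V] [DecidableEq V]

theorem addKnotChar_add (K : G.Char) (x : V → ℤ) :
    addKnotChar (K.add x) = (addKnotChar K).add x := by
  apply Subtype.ext; funext v
  simp only [addKnotChar, WeightedGraph.Char.add]; ring

/-- The induced action `t ↦ t + [K]` of the knot on spin-c structures. -/
noncomputable def addKnot : G.Spinc → G.Spinc :=
  Quotient.map addKnotChar (by
    rintro K _ ⟨x, rfl⟩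
    exact ⟨x, addKnotChar_add K x⟩)

@[simp] theorem addKnot_spinc (K : G.Char) : addKnot K.spinc = (addKnotChar K).spinc := rfl

open WeightedGraph in
/-- The action `[K, E] ↦ [K + v₀, E]` on cubes. -/
noncomputable def addKnotCube : G.Cube →o G.Cube where
  toFun c := ⟨addKnotChar c.char, c.dirs⟩
  monotone' := by
    rintro c c' ⟨h, J, hJ, e⟩
    exact ⟨h, J, hJ, by
      dsimp only
      rw [← addKnotChar_add, e]⟩

open WeightedGraph in
/-- The action of `v₀` from the cubes over `t` to the cubes over `t + [K]`. -/
noncomputable def addKnotOver (t : G.Spinc) : G.CubeOver t →o G.CubeOver (addKnot t) where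
  toFun c := ⟨addKnotCube c.1, congrArg addKnot c.2⟩
  monotone' _ _ h := addKnotCube.monotone h

open WeightedGraph in
/-- The pair `(h_U, h_V)`, where `h_V [K, E] = h_U [K + v₀, E]`. -/
noncomputable def doubleHeight (t : G.Spinc) : G.CubeOver t →o ℚ × ℚ :=
  (CubeOver.height t).prod ((CubeOver.height (addKnot t)).comp (addKnotOver t))

end KnotGraph

/-! ### The class `Σ` and the splitting of the intersection form -/

namespace WeightedGraph

variable {V : Type u} [Fintype V] [DecidableEq V] (G : WeightedGraph V)

theorem form_symm (v w : V) : G.form v w = G.form w v := by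
  by_cases h : v = w
  · subst h; rfl
  · by_cases hA : G.graph.Adj v w
    · simp [form, h, Ne.symm h, hA, hA.symm]
    · have hA' : ¬G.graph.Adj w v := fun h' => hA h'.symm
      simp [form, h, Ne.symm h, hA, hA']

theorem dot_formQ_comm (x y : V → ℚ) : x ⬝ᵥ (G.formQ *ᵥ y) = y ⬝ᵥ (G.formQ *ᵥ x) := by
  have : G.formQᵀ = G.formQ := by
    ext v w
    simp [formQ, G.form_symm v w]
  rw [Matrix.dotProduct_mulVec, ← Matrix.mulVec_transpose, this, dotProduct_comm]

variable {G}

theorem NegDef.isUnit (h : G.NegDef) : IsUnit G.formQ := by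
  rw [← Matrix.mulVec_injective_iff_isUnit]
  intro x y hxy
  by_contra hne
  have h1 := h (x - y) (sub_ne_zero.2 hne)
  have h2 : G.formQ *ᵥ (x - y) = 0 := by
    rw [Matrix.mulVec_sub, sub_eq_zero]; exact hxy
  rw [h2, dotProduct_zero] at h1
  exact lt_irrefl _ h1

theorem NegDef.mulVec_inv (h : G.NegDef) (x : V → ℚ) : G.formQ *ᵥ (G.formQ⁻¹ *ᵥ x) = x := by
  rw [Matrix.mulVec_mulVec, Matrix.mul_nonsing_inv _ ((Matrix.isUnit_iff_isUnit_det _).1 h.isUnit),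
    Matrix.one_mulVec]

theorem NegDef.inv_mulVec (h : G.NegDef) (x : V → ℚ) : G.formQ⁻¹ *ᵥ (G.formQ *ᵥ x) = x := by
  rw [Matrix.mulVec_mulVec, Matrix.nonsing_inv_mul _ ((Matrix.isUnit_iff_isUnit_det _).1 h.isUnit),
    Matrix.one_mulVec]

theorem Char.toRat_add (K : G.Char) (x : V → ℤ) :
    (K.add x).toRat = K.toRat + (2 : ℚ) • (G.formQ *ᵥ (fun v => (x v : ℚ))) := by
  funext v
  simp [toRat, add, Matrix.mulVec, dotProduct, formQ]

end WeightedGraph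

namespace KnotGraph

open WeightedGraph

variable {V : Type u} [Fintype V] [DecidableEq V] (G : KnotGraph V) (n : ℤ)

/-- `PD[v₀]` restricted to `G`, over `ℚ`. -/
noncomputable def linkQ : V → ℚ := fun v => (G.link v : ℚ)

/-- The rational class `Σ₀` of the plumbing `G` with `PD[Σ₀] = PD[v₀]`. -/
noncomputable def sigmaZero : V → ℚ := G.formQ⁻¹ *ᵥ G.linkQ

/-- The class `Σ = v₀ - Σ₀` in the rational second homology of the plumbing `G.fill n`. -/
noncomputable def sigma : Option V → ℚ := fun x => x.elim 1 (fun v => -G.sigmaZero v)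

/-- The self-intersection `Σ² = n - Σ₀²`; see `sigma_dot_sigma`. -/
noncomputable def sigmaSq : ℚ := n - G.linkQ ⬝ᵥ G.sigmaZero

variable {G n}

/-- Restriction of characteristic classes from `G.fill n` to `G`. -/
def restrict (L : (G.fill n).Char) : G.Char := ⟨fun v => L.1 (some v), fun v => L.2 (some v)⟩

/-- The evaluation `L(Σ)`. -/
noncomputable def evalSigma (L : (G.fill n).Char) : ℚ := L.toRat ⬝ᵥ G.sigma

/-- The number `Â(L) = (L(Σ) + Σ²) / 2`. -/
noncomputable def alexander (L : (G.fill n).Char) : ℚ := (evalSigma L + G.sigmaSq n) / 2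

theorem evalSigma_eq (L : (G.fill n).Char) :
    evalSigma L = L.toRat none - (restrict L).toRat ⬝ᵥ G.sigmaZero := by
  simp [evalSigma, dotProduct, Fintype.sum_option, sigma, Char.toRat, restrict, sub_eq_add_neg]

@[simp] theorem form_none_none : (G.fill n).form none none = n := by
  simp [form, fill]

@[simp] theorem form_none_some (v : V) : (G.fill n).form none (some v) = G.link v := by
  by_cases hv : v ∈ G.nbr <;> simp [form, fill, total, link, hv]

@[simp] theorem form_some_none (v : V) : (G.fill n).form (some v) none = G.link v := by
  by_cases hv : v ∈ G.nbr <;> simp [form, fill, total, link, hv]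

@[simp] theorem form_some_some (v w : V) : (G.fill n).form (some v) (some w) = G.form v w := by
  by_cases h : v = w
  · simp [form, fill, h]
  · by_cases hA : G.graph.Adj v w <;> simp [form, fill, total, h, hA]

theorem mulVec_none (x : Option V → ℚ) :
    ((G.fill n).formQ *ᵥ x) none = n * x none + G.linkQ ⬝ᵥ (fun v => x (some v)) := by
  simp [Matrix.mulVec, dotProduct, Fintype.sum_option, formQ, linkQ]

theorem mulVec_some (x : Option V → ℚ) :
    (fun v => ((G.fill n).formQ *ᵥ x) (some v)) =
      x none • G.linkQ + G.formQ *ᵥ (fun v => x (some v)) := by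
  funext v
  simp [Matrix.mulVec, dotProduct, Fintype.sum_option, formQ, linkQ, mul_comm]

theorem NegDef.base (h : (G.fill n).NegDef) : G.NegDef := by
  intro x hx
  have h1 := h (fun o => o.elim 0 x) (by
    intro h0
    apply hx
    funext v
    exact congrFun h0 (some v))
  have h2 := mulVec_some (G := G) (n := n) (fun o => o.elim 0 x)
  simp only [dotProduct, Fintype.sum_option] at h1 ⊢
  have h3 : ∀ v, ((G.fill n).formQ *ᵥ (fun o : Option V => o.elim 0 x)) (some v) =
      (G.formQ *ᵥ x) v := fun v => by simpa using congrFun h2 v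
  simpa [h3] using h1

theorem formQ_sigmaZero (h : (G.fill n).NegDef) : G.formQ *ᵥ G.sigmaZero = G.linkQ :=
  (NegDef.base h).mulVec_inv _

/-- The class `Σ` is orthogonal to the classes of the vertices of the old graph. -/
theorem formQ_sigma (h : (G.fill n).NegDef) (o : Option V) :
    ((G.fill n).formQ *ᵥ G.sigma) o = o.elim (G.sigmaSq n) (fun _ => 0) := by
  cases o with
  | none =>
    rw [mulVec_none]
    simp only [sigma, Option.elim, sigmaSq]
    rw [show (fun v => -G.sigmaZero v) = -G.sigmaZero from rfl, dotProduct_neg]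
    ring
  | some v =>
    have h1 := congrFun (mulVec_some (G := G) (n := n) G.sigma) v
    simp only [sigma, Option.elim] at h1 ⊢
    rw [h1, show (fun v => -G.sigmaZero v) = -G.sigmaZero from rfl, Matrix.mulVec_neg,
      formQ_sigmaZero h]
    simp

/-- The number `sigmaSq` is the square of `Σ`. -/
theorem sigma_dot_sigma (h : (G.fill n).NegDef) :
    G.sigma ⬝ᵥ ((G.fill n).formQ *ᵥ G.sigma) = G.sigmaSq n := by
  simp [dotProduct, Fintype.sum_option, formQ_sigma h, sigma]

theorem sigmaSq_neg (h : (G.fill n).NegDef) : G.sigmaSq n < 0 := by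
  rw [← sigma_dot_sigma h]
  apply h
  intro h0
  have := congrFun h0 none
  simp [sigma] at this

/-- The square of a characteristic class splits along `Σ`. -/
theorem sq_eq (h : (G.fill n).NegDef) (L : (G.fill n).Char) :
    L.sq = (restrict L).sq + evalSigma L ^ 2 / G.sigmaSq n := by
  have hs := (sigmaSq_neg h).ne
  have hG := NegDef.base h
  set x := (G.fill n).formQ⁻¹ *ᵥ L.toRat with hx
  have hL : (G.fill n).formQ *ᵥ x = L.toRat := h.mulVec_inv _
  set y : V → ℚ := fun v => x (some v) with hy
  have h0 : L.toRat none = n * x none + G.linkQ ⬝ᵥ y := by rw [← hL, mulVec_none]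
  have h1 : (restrict L).toRat = x none • G.linkQ + G.formQ *ᵥ y := by
    rw [← mulVec_some, hL]; rfl
  have h2 : G.formQ⁻¹ *ᵥ (restrict L).toRat = x none • G.sigmaZero + y := by
    rw [h1, Matrix.mulVec_add, hG.inv_mulVec, Matrix.mulVec_smul]; rfl
  have h3 : evalSigma L = x none * G.sigmaSq n := by
    rw [evalSigma_eq, h0, h1, add_dotProduct, dotProduct_comm (G.formQ *ᵥ y), dot_formQ_comm,
      formQ_sigmaZero h, smul_dotProduct, smul_eq_mul, sigmaSq, dotProduct_comm y]
    ring
  have h4 : L.sq = L.toRat none * x none + (restrict L).toRat ⬝ᵥ y := by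
    rw [Char.sq, ← hx]
    simp [dotProduct, Fintype.sum_option, hy, Char.toRat, restrict]
  have h5 : (restrict L).sq =
      x none * ((restrict L).toRat ⬝ᵥ G.sigmaZero) + (restrict L).toRat ⬝ᵥ y := by
    rw [Char.sq, h2, dotProduct_add, dotProduct_smul, smul_eq_mul]
  have h6 := evalSigma_eq L
  rw [h3, h4, h5, mul_pow]
  have : x none ^ 2 * G.sigmaSq n ^ 2 / G.sigmaSq n = x none * evalSigma L := by
    rw [h3]; field_simp
  rw [this, h6]
  ring

/-- The grading shift `((2i - r)² + r) / (4r)` of the two-handle cobordism, where `r = Σ²`. -/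
noncomputable def gradingShift (r i : ℚ) : ℚ := ((2 * i - r) ^ 2 + r) / (4 * r)

theorem gradingShift_add {r : ℚ} (hr : r ≠ 0) (i : ℚ) :
    gradingShift r (i + r) = gradingShift r i + 2 * i := by
  unfold gradingShift; field_simp; ring

theorem height_eq (h : (G.fill n).NegDef) (L : (G.fill n).Char) :
    L.height = (restrict L).height + gradingShift (G.sigmaSq n) (alexander L) := by
  have hs := (sigmaSq_neg h).ne
  unfold Char.height gradingShift alexander
  rw [sq_eq h, Fintype.card_option]
  push_cast
  field_simp
  ring

/-- Restriction of `L + [x]`. -/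
theorem restrict_add (L : (G.fill n).Char) (x : Option V → ℤ) (v : V) :
    (restrict (L.add x)).1 v =
      ((restrict L).add (fun w => x (some w))).1 v + 2 * (x none * G.link v) := by
  simp [restrict, Char.add, Matrix.mulVec, dotProduct, Fintype.sum_option]
  ring

theorem alexander_add (h : (G.fill n).NegDef) (L : (G.fill n).Char) (x : Option V → ℤ) :
    alexander (L.add x) = alexander L + x none * G.sigmaSq n := by
  have : evalSigma (L.add x) = evalSigma L + 2 * (x none * G.sigmaSq n) := by
    unfold evalSigma
    rw [Char.toRat_add, add_dotProduct, smul_dotProduct, dotProduct_comm (_ *ᵥ _), dot_formQ_comm]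
    simp [dotProduct, Fintype.sum_option, formQ_sigma h]
  unfold alexander
  rw [this]; ring

/-- A second homology class of `G` as a class of `G.fill n`. -/
def extend (x : V → ℤ) : Option V → ℤ := fun o => o.elim 0 x

theorem restrict_add_extend (L : (G.fill n).Char) (x : V → ℤ) :
    restrict (L.add (extend x)) = (restrict L).add x := by
  apply Subtype.ext; funext v
  rw [restrict_add]; simp [extend]

theorem alexander_add_extend (h : (G.fill n).NegDef) (L : (G.fill n).Char) (x : V → ℤ) :
    alexander (L.add (extend x)) = alexander L := by
  rw [alexander_add h]; simp [extend]

/-- The class of the sphere at `v₀`. -/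
def core : Option V → ℤ := fun o => o.elim 1 (fun _ => 0)

theorem restrict_add_core (L : (G.fill n).Char) :
    restrict (L.add core) = addKnotChar (restrict L) := by
  apply Subtype.ext; funext v
  rw [restrict_add]
  simp [core, addKnotChar, Char.add, Matrix.mulVec, dotProduct]

theorem alexander_add_core (h : (G.fill n).NegDef) (L : (G.fill n).Char) :
    alexander (L.add core) = alexander L + G.sigmaSq n := by
  rw [alexander_add h]; simp [core]

theorem link_dual (o : Option V) : (G.dual n).link o = o.elim 1 (fun _ => 0) := by
  cases o <;> simp [link]

theorem restrict_addKnot_dual (L : (G.fill n).Char) :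
    restrict (addKnotChar (G := G.dual n) L) = restrict L := by
  apply Subtype.ext; funext v
  simp [restrict, addKnotChar, link_dual]

theorem alexander_addKnot_dual (L : (G.fill n).Char) :
    alexander (addKnotChar (G := G.dual n) L) = alexander L + 1 := by
  have h : evalSigma (addKnotChar (G := G.dual n) L) = evalSigma L + 2 := by
    refine (evalSigma_eq _).trans ?_
    rw [evalSigma_eq, restrict_addKnot_dual]
    simp [Char.toRat, addKnotChar, link_dual]
    ring
  unfold alexander
  rw [h]
  ring

/-- Gradings over `G` are shifted to gradings over `G.fill n`. -/
theorem fst_mem_aux (h : (G.fill n).NegDef) (L : (G.fill n).Char) {q : ℚ}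
    (hq : q ∈ gradingCoset (restrict L).spinc) :
    q + gradingShift (G.sigmaSq n) (alexander L) ∈ gradingCoset L.spinc := by
  obtain ⟨K, hK, m, rfl⟩ := hq
  obtain ⟨x, rfl⟩ := Char.spinc_eq_iff.1 hK.symm
  refine ⟨L.add (extend x), Char.spinc_add _ _, m, ?_⟩
  rw [height_eq h, restrict_add_extend, alexander_add_extend h]
  ring

/-- The grading cosets of `t` and `t + [K]` differ by twice the Alexander coset. -/
theorem alexander_mem_aux (h : (G.fill n).NegDef) (L : (G.fill n).Char) {q : ℚ}
    (hq : q ∈ gradingCoset (addKnot (restrict L).spinc)) :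
    q + 2 * alexander L ∈ gradingCoset (restrict L).spinc := by
  have hG := NegDef.base h
  obtain ⟨K, hK, m, rfl⟩ := hq
  obtain ⟨x, rfl⟩ := Char.spinc_eq_iff.1 hK.symm
  obtain ⟨k, hk⟩ : ∃ k : ℤ, L.1 none + n = 2 * k := by
    have := L.2 none
    simp only [fill, Option.elim, Int.ModEq] at this
    exact ⟨(L.1 none + n) / 2, by omega⟩
  have hk' : L.toRat none + n = 2 * k := by unfold Char.toRat; exact_mod_cast hk
  refine ⟨(restrict L).add x, Char.spinc_add _ _, m + k + ∑ v, x v * G.link v, ?_⟩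
  rw [← addKnotChar_add]
  set K := (restrict L).add x with hKdef
  have e1 : (addKnotChar K).toRat = K.toRat + (2 : ℚ) • G.linkQ := by
    funext v; simp [Char.toRat, addKnotChar, linkQ]
  have e2 : (addKnotChar K).sq =
      K.sq + 4 * (K.toRat ⬝ᵥ G.sigmaZero) + 4 * (G.linkQ ⬝ᵥ G.sigmaZero) := by
    have : G.linkQ ⬝ᵥ (G.formQ⁻¹ *ᵥ K.toRat) = K.toRat ⬝ᵥ G.sigmaZero := by
      rw [← formQ_sigmaZero h, dotProduct_comm, dot_formQ_comm, hG.mulVec_inv, dotProduct_comm]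
    rw [Char.sq, e1, Matrix.mulVec_add, Matrix.mulVec_smul, add_dotProduct, dotProduct_add,
      dotProduct_add, smul_dotProduct, smul_dotProduct, dotProduct_smul, dotProduct_smul, this]
    simp only [smul_eq_mul, Char.sq, sigmaZero]
    ring
  have e3 : K.toRat ⬝ᵥ G.sigmaZero =
      (restrict L).toRat ⬝ᵥ G.sigmaZero + 2 * ∑ v, (x v : ℚ) * G.link v := by
    rw [hKdef, Char.toRat_add, add_dotProduct, smul_dotProduct, dotProduct_comm (_ *ᵥ _),
      dot_formQ_comm, formQ_sigmaZero h]
    simp [dotProduct, linkQ]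
  unfold Char.height alexander sigmaSq
  rw [e2, evalSigma_eq, e3]
  push_cast
  linear_combination hk'

end KnotGraph

/-! ### Doubly filtered spaces with flip map -/

open FiltSSet

/-- Left Kan extension along the first projection: keeps the first height. -/
abbrev p₁ : FiltSSet.{u} (ℚ × ℚ) ⥤ FiltSSet.{u} ℚ := reindex OrderHom.fst

/-- Left Kan extension along the second projection: keeps the second height. -/
abbrev p₂ : FiltSSet.{u} (ℚ × ℚ) ⥤ FiltSSet.{u} ℚ := reindex OrderHom.snd

/-- The height change `min (h₁, h₂ + 2i)` of the restriction along `q ↦ (q, q - 2i)`. -/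
def alexanderMap (i : ℚ) : ℚ × ℚ →o ℚ where
  toFun x := min x.1 (x.2 + 2 * i)
  monotone' _ _ h := min_le_min h.1 (add_le_add_left h.2 _)

/-- The grading shift by `c`. -/
def shiftMap (c : ℚ) : ℚ →o ℚ where
  toFun x := x + c
  monotone' _ _ h := add_le_add_left h _

/-- The simplices in level `p` of the filtration. -/
def FiltSSet.level {P : Type} [Preorder P] (X : FiltSSet.{u} P) (p : P) (m : SimplexCategoryᵒᵖ) :
    Set (X.space.obj m) :=
  {x | p ≤ X.height x}

/-- Restriction along `q ↦ (q, q - 2i)` in terms of levels. -/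
theorem level_alexanderMap (X : FiltSSet.{u} (ℚ × ℚ)) (i q : ℚ) (m : SimplexCategoryᵒᵖ) :
    ((reindex (alexanderMap i)).obj X).level q m = X.level (q, q - 2 * i) m := by
  ext x
  change q ≤ min (X.height x).1 ((X.height x).2 + 2 * i) ↔
    q ≤ (X.height x).1 ∧ q - 2 * i ≤ (X.height x).2
  rw [le_min_iff, sub_le_iff_le_add]

/-- The levels of `p₁` are the unions of the levels of the double filtration. -/
theorem level_p₁ (X : FiltSSet.{u} (ℚ × ℚ)) (q : ℚ) (m : SimplexCategoryᵒᵖ) :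
    (p₁.obj X).level q m = ⋃ r : ℚ, X.level (q, r) m := by
  ext x
  refine ⟨fun h => Set.mem_iUnion.2 ⟨(X.height x).2, h, le_rfl⟩, fun h => ?_⟩
  obtain ⟨_, h⟩ := Set.mem_iUnion.1 h
  exact h.1

/-- The levels of `p₂` are the unions of the levels of the double filtration. -/
theorem level_p₂ (X : FiltSSet.{u} (ℚ × ℚ)) (q : ℚ) (m : SimplexCategoryᵒᵖ) :
    (p₂.obj X).level q m = ⋃ r : ℚ, X.level (r, q) m := by
  ext x
  refine ⟨fun h => Set.mem_iUnion.2 ⟨(X.height x).1, le_rfl, h⟩, fun h => ?_⟩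
  obtain ⟨_, h⟩ := Set.mem_iUnion.1 h
  exact h.2

open WeightedGraph in
/-- An object of the category of doubly filtered spaces with flip map for the boundary `Y` of the
plumbing `G` and the knot of `v₀`: for each spin-c structure `t` a doubly filtered simplicial set
with heights in `gr(Y, t)` and `gr(Y, t + [K])`, and a filtered flip map from the first entry
with its second filtration to the entry at `t + [K]` with its first filtration. -/
structure KnotSpace {V : Type u} [Fintype V] [DecidableEq V] (G : KnotGraph V) where
  space : G.Spinc → FiltSSet.{u} (ℚ × ℚ)
  fst_mem : ∀ (t : G.Spinc) {m : SimplexCategoryᵒᵖ} (x : (space t).space.obj m),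
    ((space t).height x).1 ∈ gradingCoset t
  snd_mem : ∀ (t : G.Spinc) {m : SimplexCategoryᵒᵖ} (x : (space t).space.obj m),
    ((space t).height x).2 ∈ gradingCoset (KnotGraph.addKnot t)
  flip : ∀ t : G.Spinc, p₂.obj (space t) ⟶ p₁.obj (space (KnotGraph.addKnot t))

namespace KnotSpace

variable {V : Type u} [Fintype V] [DecidableEq V] {G : KnotGraph V}

/-- Morphisms: doubly filtered maps at each spin-c structure, commuting with the flip maps. -/
@[ext]
structure Hom (X Y : KnotSpace G) where
  app : ∀ t : G.Spinc, X.space t ⟶ Y.space t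
  comm : ∀ t : G.Spinc,
    p₂.map (app t) ≫ Y.flip t = X.flip t ≫ p₁.map (app (KnotGraph.addKnot t))

instance : Category (KnotSpace G) where
  Hom := Hom
  id X := { app := fun t => 𝟙 (X.space t), comm := fun t => rfl }
  comp f g := { app := fun t => f.app t ≫ g.app t, comm := fun t => by
                  rw [Functor.map_comp, Functor.map_comp, Category.assoc, g.comm,
                    ← Category.assoc, f.comm, Category.assoc] }
  id_comp f := Hom.ext (funext fun t => Category.id_comp (f.app t))
  comp_id f := Hom.ext (funext fun t => Category.comp_id (f.app t))
  assoc f g h := Hom.ext (funext fun t => Category.assoc (f.app t) (g.app t) (h.app t))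

end KnotSpace

namespace KnotGraph

open WeightedGraph

variable {V : Type u} [Fintype V] [DecidableEq V]

/-- The knot lattice space: at `t` the homotopy colimit over the cubes of points of height
`(h_U, h_V)`; the flip map is induced by `[K, E] ↦ [K + v₀, E]`. -/
noncomputable def knotLattice (G : KnotGraph V) : KnotSpace G where
  space t := hocolim (points (doubleHeight t))
  fst_mem := by
    rintro t m ⟨c, -⟩
    have h := (c.obj 0).1.height_mem
    rw [(c.obj 0).2] at h
    exact h
  snd_mem := by
    rintro t m ⟨c, -⟩
    have h := (addKnotOver t (c.obj 0)).1.height_mem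
    rw [(addKnotOver t (c.obj 0)).2] at h
    exact h
  flip t := pointsMap (h := OrderHom.snd.comp (doubleHeight t))
    (h' := OrderHom.fst.comp (doubleHeight (addKnot t))) (addKnotOver t) (fun _ => le_rfl)

variable (G : KnotGraph V) (n : ℤ)

/-- The spin-c structures on the two-handle cobordism which restrict to `q` on the surgered
manifold, as pairs `(t, i)`: `t` is the restriction to the boundary of `G` and `i` the value of `Â`. -/
@[ext]
structure SpincW (q : (G.fill n).Spinc) where
  spinc : G.Spinc
  alex : ℚ
  mem : ∃ L : (G.fill n).Char, L.spinc = q ∧ spinc = (restrict L).spinc ∧ alex = alexander L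

/-- The objects `(t, i, a)` and `(t, i, b)` of the index category of the surgery formula at `q`. -/
inductive Index (q : (G.fill n).Spinc) : Type u
  | a (p : G.SpincW n q)
  | b (p : G.SpincW n q)

/-- The morphisms: identities, `λ : (t, i, a) ⟶ (t, i, b)` and
`ρ : (t, i, a) ⟶ (t + [K], i + Σ², b)`.  The second index of the target of `ρ` is a variable `i'`
equal to `i + Σ²`; the target is always an object by `SpincW.mem_core`. -/
inductive Index.Hom (q : (G.fill n).Spinc) : G.Index n q → G.Index n q → Type u
  | id (j : G.Index n q) : Index.Hom q j j
  | lam (p : G.SpincW n q) : Index.Hom q (.a p) (.b p)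
  | rho (p : G.SpincW n q) (i' : ℚ) (hi' : i' = p.alex + G.sigmaSq n)
      (mem : ∃ L : (G.fill n).Char,
        L.spinc = q ∧ addKnot p.spinc = (restrict L).spinc ∧ i' = alexander L) :
      Index.Hom q (.a p) (.b ⟨addKnot p.spinc, i', mem⟩)

variable {G n}

/-- The action of the core: `(t + [K], i + Σ²)` is again a spin-c structure restricting to `q`. -/
theorem SpincW.mem_core (h : (G.fill n).NegDef) {q : (G.fill n).Spinc} (p : G.SpincW n q) :
    ∃ L : (G.fill n).Char, L.spinc = q ∧ addKnot p.spinc = (restrict L).spinc ∧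
      p.alex + G.sigmaSq n = alexander L := by
  obtain ⟨L, hL, h1, h2⟩ := p.mem
  refine ⟨L.add core, by simpa using hL, ?_, ?_⟩
  · rw [h1, addKnot_spinc, restrict_add_core]
  · rw [h2, alexander_add_core h]

/-- Composition; one of two composable morphisms is an identity. -/
def Index.Hom.comp {q : (G.fill n).Spinc} : {x y z : G.Index n q} →
    Index.Hom G n q x y → Index.Hom G n q y z → Index.Hom G n q x z
  | _, _, _, .id _, g => g
  | _, _, _, .lam p, .id _ => .lam p
  | _, _, _, .rho p i' h m, .id _ => .rho p i' h m

instance (q : (G.fill n).Spinc) : SmallCategory (G.Index n q) where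
  Hom := Index.Hom G n q
  id := .id
  comp := Index.Hom.comp
  id_comp _ := rfl
  comp_id f := by cases f <;> rfl
  assoc f g h := by cases f <;> cases g <;> cases h <;> rfl

/-- The action of the cocore `(t, i) ↦ (t, i + 1)`, which covers the action of the dual knot. -/
noncomputable def SpincW.cocore {q : (G.fill n).Spinc} (p : G.SpincW n q) :
    G.SpincW n (addKnot (G := G.dual n) q) where
  spinc := p.spinc
  alex := p.alex + 1
  mem := by
    obtain ⟨L, hL, h1, h2⟩ := p.mem
    refine ⟨addKnotChar (G := G.dual n) L, congrArg (addKnot (G := G.dual n)) hL, ?_, ?_⟩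
    · rw [h1, restrict_addKnot_dual]
    · rw [h2, alexander_addKnot_dual]

variable (G n) in
/-- The shift `i ↦ i + 1` of the index categories. -/
noncomputable def shiftIndex (q : (G.fill n).Spinc) :
    G.Index n q ⥤ G.Index n (addKnot (G := G.dual n) q) where
  obj
    | .a p => .a p.cocore
    | .b p => .b p.cocore
  map
    | .id _ => .id _
    | .lam p => .lam p.cocore
    | .rho p i' h m => .rho p.cocore (i' + 1) (by rw [h]; simp only [SpincW.cocore]; ring)
        (SpincW.cocore ⟨addKnot p.spinc, i', m⟩).mem
  map_id j := by cases j <;> rfl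
  map_comp {j j' j''} f g := by
    change Index.Hom G n q j j' at f
    change Index.Hom G n q j' j'' at g
    cases f <;> cases g <;> rfl

/-- The height on `A_{t,i}`: restriction along `q ↦ (q, q - 2i)`, followed by the grading shift. -/
noncomputable def heightA (r i : ℚ) : ℚ × ℚ →o ℚ :=
  (shiftMap (gradingShift r i)).comp (alexanderMap i)

/-- The height on `B_{t,i}`: the first height, followed by the grading shift. -/
noncomputable def heightB (r i : ℚ) : ℚ × ℚ →o ℚ :=
  (shiftMap (gradingShift r i)).comp OrderHom.fst

theorem heightA_le_heightB (r i : ℚ) (x : ℚ × ℚ) : heightA r i x ≤ heightB r i x :=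
  add_le_add_left (min_le_left _ _) _

theorem heightA_le_heightB_flip {r : ℚ} (hr : r ≠ 0) (i : ℚ) {x y : ℚ × ℚ} (h : x.2 ≤ y.1) :
    heightA r i x ≤ heightB r (i + r) y := by
  change min x.1 (x.2 + 2 * i) + gradingShift r i ≤ y.1 + gradingShift r (i + r)
  rw [gradingShift_add hr]
  have := min_le_right x.1 (x.2 + 2 * i)
  linarith

/-- The doubly filtered spaces of the dual knot diagram: at `(t, i, a)` the space `X_t` with the
heights of `A_{t,i}` and `A_{t,i+1}`, at `(t, i, b)` with those of `B_{t,i}` and `B_{t,i+1}`. -/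
noncomputable def doubleObj (X : KnotSpace G) (q : (G.fill n).Spinc) :
    G.Index n q → FiltSSet.{u} (ℚ × ℚ)
  | .a p => (reindex ((heightA (G.sigmaSq n) p.alex).prod
      (heightA (G.sigmaSq n) (p.alex + 1)))).obj (X.space p.spinc)
  | .b p => (reindex ((heightB (G.sigmaSq n) p.alex).prod
      (heightB (G.sigmaSq n) (p.alex + 1)))).obj (X.space p.spinc)

theorem rho_mono (hneg : (G.fill n).NegDef) (X : KnotSpace G) (t : G.Spinc) (i i' : ℚ)
    (hi' : i' = i + G.sigmaSq n) {m : SimplexCategoryᵒᵖ} (x : (X.space t).space.obj m) :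
    ((heightA (G.sigmaSq n) i).prod (heightA (G.sigmaSq n) (i + 1))) ((X.space t).height x) ≤
      ((heightB (G.sigmaSq n) i').prod (heightB (G.sigmaSq n) (i' + 1)))
        ((X.space (addKnot t)).height ((X.flip t).base.app m x)) := by
  subst hi'
  have hr := (sigmaSq_neg hneg).ne
  have hx := (X.flip t).mono x
  refine ⟨heightA_le_heightB_flip hr _ hx, ?_⟩
  have := heightA_le_heightB_flip hr (i + 1) hx
  rw [add_right_comm] at this
  exact this

/-- The maps of the dual knot diagram: `λ` is the identity on underlying spaces, `ρ` the flip map. -/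
noncomputable def doubleMap (hneg : (G.fill n).NegDef) (X : KnotSpace G) (q : (G.fill n).Spinc) :
    {j j' : G.Index n q} → Index.Hom G n q j j' → (doubleObj X q j ⟶ doubleObj X q j')
  | _, _, .id j => 𝟙 (doubleObj X q j)
  | _, _, .lam p =>
      { base := 𝟙 (X.space p.spinc).space
        mono := fun _ => ⟨heightA_le_heightB _ _ _, heightA_le_heightB _ _ _⟩ }
  | _, _, .rho p i' h _ =>
      { base := (X.flip p.spinc).base
        mono := rho_mono hneg X p.spinc p.alex i' h }

/-- The dual knot surgery diagram of `X` at the spin-c structure `q` of the surgered manifold. -/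
noncomputable def doubleDiagram (hneg : (G.fill n).NegDef) (X : KnotSpace G) (q : (G.fill n).Spinc) :
    G.Index n q ⥤ FiltSSet.{u} (ℚ × ℚ) where
  obj := doubleObj X q
  map f := doubleMap hneg X q f
  map_id _ := rfl
  map_comp {j j' j''} f g := by
    change Index.Hom G n q j j' at f
    change Index.Hom G n q j' j'' at g
    cases f <;> cases g <;> rfl

/-- The surgery diagram of `X` at `q`: the spaces `A_{t,i}` and `B_{t,i}` with one filtration. -/
noncomputable def diagram (hneg : (G.fill n).NegDef) (X : KnotSpace G) (q : (G.fill n).Spinc) :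
    G.Index n q ⥤ FiltSSet.{u} ℚ :=
  doubleDiagram hneg X q ⋙ p₁

/-- The identity transformation from the dual knot diagram with its second filtration to the
shifted dual knot diagram with its first filtration. -/
noncomputable def flipDiagram (hneg : (G.fill n).NegDef) (X : KnotSpace G) (q : (G.fill n).Spinc) :
    doubleDiagram hneg X q ⋙ p₂ ⟶
      shiftIndex G n q ⋙ doubleDiagram hneg X (addKnot (G := G.dual n) q) ⋙ p₁ where
  app
    | .a p => { base := 𝟙 (X.space p.spinc).space, mono := fun _ => le_rfl }
    | .b p => { base := 𝟙 (X.space p.spinc).space, mono := fun _ => le_rfl }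
  naturality j j' f := by
    change Index.Hom G n q j j' at f
    cases f with
    | id j => cases j <;> rfl
    | lam p => rfl
    | rho p i' h m => rfl

theorem heightA_mem (hneg : (G.fill n).NegDef) (X : KnotSpace G) {q : (G.fill n).Spinc} (p : G.SpincW n q)
    {m : SimplexCategoryᵒᵖ} (x : (X.space p.spinc).space.obj m) :
    heightA (G.sigmaSq n) p.alex ((X.space p.spinc).height x) ∈ gradingCoset q := by
  obtain ⟨t, i, L, rfl, rfl, rfl⟩ := p
  apply fst_mem_aux hneg
  change min _ _ ∈ _
  rcases min_choice ((X.space (restrict L).spinc).height x).1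
    (((X.space (restrict L).spinc).height x).2 + 2 * alexander L) with h | h
  · rw [h]; exact X.fst_mem _ x
  · rw [h]; exact alexander_mem_aux hneg L (X.snd_mem _ x)

theorem heightB_mem (hneg : (G.fill n).NegDef) (X : KnotSpace G) {q : (G.fill n).Spinc} (p : G.SpincW n q)
    {m : SimplexCategoryᵒᵖ} (x : (X.space p.spinc).space.obj m) :
    heightB (G.sigmaSq n) p.alex ((X.space p.spinc).height x) ∈ gradingCoset q := by
  obtain ⟨t, i, L, rfl, rfl, rfl⟩ := p
  exact fst_mem_aux hneg L (X.fst_mem _ x)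

/-- The dual knot surgery of `X`: the homotopy colimits of the dual knot diagrams, with the flip
map induced by the shift `i ↦ i + 1`. -/
noncomputable def surgery (hneg : (G.fill n).NegDef) (X : KnotSpace G) : KnotSpace (G.dual n) where
  space q := hocolim (doubleDiagram hneg X q)
  fst_mem := by
    rintro q m ⟨c, x⟩
    change ((((doubleDiagram hneg X q).obj (c.obj 0)).height x).1) ∈ _
    change ((doubleDiagram hneg X q).obj (c.obj 0)).space.obj m at x
    revert x
    generalize c.obj 0 = j
    cases j with
    | a p => exact fun x => heightA_mem hneg X p x
    | b p => exact fun x => heightB_mem hneg X p x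
  snd_mem := by
    rintro q m ⟨c, x⟩
    change ((((doubleDiagram hneg X q).obj (c.obj 0)).height x).2) ∈ _
    change ((doubleDiagram hneg X q).obj (c.obj 0)).space.obj m at x
    revert x
    generalize c.obj 0 = j
    cases j with
    | a p => exact fun x => heightA_mem hneg X p.cocore x
    | b p => exact fun x => heightB_mem hneg X p.cocore x
  flip q := hocolimMap (shiftIndex G n q) (flipDiagram hneg X q)

/-! ### The decomposition of the lattice space of the filled graph -/

namespace Index

variable {q : (G.fill n).Spinc}

/-- The pair `(t, i)`. -/
def point : G.Index n q → G.SpincW n q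
  | .a p => p
  | .b p => p

/-- Whether the object is of the form `(t, i, a)`. -/
def OnA : G.Index n q → Prop
  | .a _ => True
  | .b _ => False

end Index

/-- The cubes `[L, E]` over `q` belonging to the object `j` of the index category: for
`j = (t, i, a)` those with `L|_G` over `t`, `Â(L) = i` and `v₀ ∈ E`, for `j = (t, i, b)` those with
`v₀ ∉ E` instead. -/
abbrev Piece (q : (G.fill n).Spinc) (j : G.Index n q) : Type u :=
  {c : (G.fill n).Cube // c.char.spinc = q ∧ (restrict c.char).spinc = j.point.spinc ∧
    alexander c.char = j.point.alex ∧ (none ∈ c.dirs ↔ j.OnA)}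

/-- The height `h_U` on a piece. -/
noncomputable def Piece.height (q : (G.fill n).Spinc) (j : G.Index n q) : Piece q j →o ℚ where
  toFun c := c.1.height
  monotone' _ _ h := Cube.height_mono h

theorem erase_le (c : (G.fill n).Cube) : c ≤ ⟨c.char, c.dirs.erase none⟩ :=
  ⟨Finset.erase_subset _ _, ∅, Finset.empty_subset _, by
    rw [show ind (∅ : Finset (Option V)) = 0 by funext v; simp [ind], Char.add_zero]⟩

theorem ind_singleton_none : ind ({none} : Finset (Option V)) = core := by
  funext o; cases o <;> simp [ind, core]

theorem core_le (c : (G.fill n).Cube) (h : none ∈ c.dirs) :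
    c ≤ ⟨c.char.add core, c.dirs.erase none⟩ :=
  ⟨Finset.erase_subset _ _, {none}, by simp [h], by rw [ind_singleton_none]⟩

theorem core_mem (hneg : (G.fill n).NegDef) {q : (G.fill n).Spinc} {p : G.SpincW n q} {i' : ℚ}
    (hi' : i' = p.alex + G.sigmaSq n) (c : Piece q (.a p)) :
    (c.1.char.add core).spinc = q ∧ (restrict (c.1.char.add core)).spinc = addKnot p.spinc ∧
      alexander (c.1.char.add core) = i' := by
  refine ⟨by rw [Char.spinc_add]; exact c.2.1, ?_, ?_⟩
  · rw [restrict_add_core, ← addKnot_spinc, c.2.2.1]; rfl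
  · rw [alexander_add_core hneg, c.2.2.2.1, hi']; rfl

/-- The maps between pieces: `λ` sends `[L, E]` to its front face `[L, E \ {v₀}]`, and `ρ` to its
back face `[L + v₀, E \ {v₀}]`. -/
noncomputable def pushFun (hneg : (G.fill n).NegDef) {q : (G.fill n).Spinc} : {j j' : G.Index n q} →
    Index.Hom G n q j j' → Piece q j → Piece q j'
  | _, _, .id _, c => c
  | _, _, .lam _, c => ⟨⟨c.1.char, c.1.dirs.erase none⟩, c.2.1, c.2.2.1, c.2.2.2.1, by
      simp [Index.OnA]⟩
  | _, _, .rho _ _ hi' _, c => ⟨⟨c.1.char.add core, c.1.dirs.erase none⟩,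
      (core_mem hneg hi' c).1, (core_mem hneg hi' c).2.1, (core_mem hneg hi' c).2.2, by
      simp [Index.OnA]⟩

theorem le_pushFun (hneg : (G.fill n).NegDef) {q : (G.fill n).Spinc} {j j' : G.Index n q} (f : Index.Hom G n q j j')
    (c : Piece q j) : c.1 ≤ (pushFun hneg f c).1 := by
  cases f with
  | id => exact le_rfl
  | lam p => exact erase_le _
  | rho p i' h m => exact core_le _ (c.2.2.2.2.2 trivial)

theorem pushFun_mono (hneg : (G.fill n).NegDef) {q : (G.fill n).Spinc} {j j' : G.Index n q} (f : Index.Hom G n q j j') :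
    Monotone (pushFun hneg f) := by
  have key : ∀ (p : G.SpincW n q) {c c' : Piece q (.a p)}, c ≤ c' →
      c'.1.dirs.erase none ⊆ c.1.dirs.erase none ∧
      ∃ J ⊆ (c.1.dirs.erase none) \ (c'.1.dirs.erase none),
        c'.1.char = c.1.char.add (ind J) := by
    rintro p c c' ⟨h, J, hJ, e⟩
    refine ⟨Finset.erase_subset_erase _ h, J, ?_, e⟩
    intro v hv
    have h1 := Finset.mem_sdiff.1 (hJ hv)
    have h2 : v ≠ none := by
      rintro rfl
      exact h1.2 (c'.2.2.2.2.2 trivial)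
    simp [h1.1, h1.2, h2]
  intro c c' hc
  cases f with
  | id => exact hc
  | lam p => exact key p hc
  | rho p i' h m =>
    obtain ⟨h1, J, hJ, e⟩ := key p hc
    refine ⟨h1, J, hJ, ?_⟩
    simp only [pushFun]
    rw [e, Char.add_add, Char.add_add, add_comm]

/-- The map `pushFun` as a monotone map. -/
noncomputable def push (hneg : (G.fill n).NegDef) {q : (G.fill n).Spinc} {j j' : G.Index n q} (f : j ⟶ j') :
    Piece q j →o Piece q j' where
  toFun := pushFun hneg f
  monotone' := pushFun_mono hneg f

theorem push_id (hneg : (G.fill n).NegDef) {q : (G.fill n).Spinc} (j : G.Index n q) : push hneg (𝟙 j) = OrderHom.id := rfl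

theorem push_comp (hneg : (G.fill n).NegDef) {q : (G.fill n).Spinc} {j j' j'' : G.Index n q} (f : j ⟶ j') (g : j' ⟶ j'') :
    push hneg (f ≫ g) = (push hneg g).comp (push hneg f) := by
  change Index.Hom G n q j j' at f
  change Index.Hom G n q j' j'' at g
  cases f <;> cases g <;> rfl

/-- The diagram of the lattice spaces of the pieces, with the face maps in the direction of `v₀`. -/
noncomputable def pieceDiagram (hneg : (G.fill n).NegDef) (q : (G.fill n).Spinc) : G.Index n q ⥤ FiltSSet.{u} ℚ where
  obj j := hocolim (points (Piece.height q j))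
  map f := pointsMap (push hneg f) (fun c => Cube.height_mono (le_pushFun hneg f c))
  map_id _ := rfl
  map_comp {j j' j''} f g := by
    change Index.Hom G n q j j' at f
    change Index.Hom G n q j' j'' at g
    cases f <;> cases g <;> rfl

/-! ### Assembling the pieces -/

theorem push_chain (hneg : (G.fill n).NegDef) {q : (G.fill n).Spinc} {k : ℕ} (c : ComposableArrows (G.Index n q) k)
    (s : ComposableArrows (Piece q (c.obj 0)) k) {i j : Fin (k + 1)} (h : i ≤ j) :
    (push hneg (c.map (homOfLE (Fin.zero_le i))) (s.obj i)).1 ≤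
      (push hneg (c.map (homOfLE (Fin.zero_le j))) (s.obj j)).1 := by
  have e : c.map (homOfLE (Fin.zero_le j)) =
      c.map (homOfLE (Fin.zero_le i)) ≫ c.map (homOfLE h) := by rw [← c.map_comp]; rfl
  rw [e, push_comp]
  refine le_trans (le_pushFun hneg (c.map (homOfLE h)) _) ?_
  exact (push hneg (c.map (homOfLE h))).monotone
    ((push hneg (c.map (homOfLE (Fin.zero_le i)))).monotone (leOfHom (s.map (homOfLE h))))

theorem push_trans (hneg : (G.fill n).NegDef) {q : (G.fill n).Spinc} {k : ℕ} (c : ComposableArrows (G.Index n q) k)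
    {i j l : Fin (k + 1)} (a : i ⟶ j) (b : j ⟶ l) (d : i ⟶ l) (x : Piece q (c.obj i)) :
    push hneg (c.map b) (push hneg (c.map a) x) = push hneg (c.map d) x := by
  have : d = a ≫ b := Subsingleton.elim _ _
  subst this
  rw [c.map_comp, push_comp]
  rfl

/-- The chain of cubes obtained from a chain of indices and a chain of cubes in its first piece. -/
noncomputable def fubiniChain (hneg : (G.fill n).NegDef) {q : (G.fill n).Spinc} {k : ℕ}
    (c : ComposableArrows (G.Index n q) k) (s : ComposableArrows (Piece q (c.obj 0)) k) :
    ComposableArrows ((G.fill n).CubeOver q) k :=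
  Monotone.functor (f := fun i => ⟨(push hneg (c.map (homOfLE (Fin.zero_le i))) (s.obj i)).1,
    (push hneg (c.map (homOfLE (Fin.zero_le i))) (s.obj i)).2.1⟩)
    (fun _ _ h => push_chain hneg c s h)

/-- The canonical map from the homotopy colimit of the pieces to the lattice space of `G.fill n`. -/
noncomputable def fubini (hneg : (G.fill n).NegDef) (q : (G.fill n).Spinc) :
    hocolim (pieceDiagram hneg q) ⟶ (G.fill n).lattice q where
  base :=
    { app := fun m => ↾fun x => ⟨fubiniChain hneg x.1 x.2.1, PUnit.unit⟩
      naturality := fun m m' f => by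
        apply ConcreteCategory.hom_ext
        rintro ⟨c, s, y⟩
        refine Sigma.ext ?_ HEq.rfl
        refine nerve.ext_of_isThin (funext fun i => Subtype.ext ?_)
        have h := congrArg Subtype.val (push_trans hneg c
          (homOfLE (Fin.zero_le (f.unop.toOrderHom 0)))
          (homOfLE (f.unop.toOrderHom.monotone (Fin.zero_le i)))
          (homOfLE (Fin.zero_le (f.unop.toOrderHom i))) (s.obj (f.unop.toOrderHom i)))
        exact h }
  mono := by
    rintro m ⟨c, s, y⟩
    change ((s.obj 0).1).height ≤ _
    exact Cube.height_mono (le_pushFun hneg _ (s.obj 0))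

/-- The map `[L, E] ↦ [L|_G, E \ {v₀}]` of cubes. -/
noncomputable def phiFun (q : (G.fill n).Spinc) (j : G.Index n q) :
    Piece q j →o G.CubeOver j.point.spinc where
  toFun c := ⟨⟨restrict c.1.char, c.1.dirs.eraseNone⟩, c.2.2.1⟩
  monotone' := by
    rintro c c' ⟨h, J, hJ, e⟩
    have hn : none ∉ J := fun h' => by
      have h1 := Finset.mem_sdiff.1 (hJ h')
      exact h1.2 (c'.2.2.2.2.2 (c.2.2.2.2.1 h1.1))
    refine ⟨Finset.eraseNone.monotone h, J.eraseNone, ?_, ?_⟩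
    · intro v hv
      have := Finset.mem_sdiff.1 (hJ (Finset.mem_eraseNone.1 hv))
      simpa using this
    · dsimp only
      rw [e, ← restrict_add_extend]
      congr 2
      funext o
      cases o <;> simp [ind, extend, hn]

/-- The underlying map of `Φ` at the object `j`: it is induced by `[L, E] ↦ [L|_G, E \ {v₀}]`. -/
noncomputable def phi (hneg : (G.fill n).NegDef) (q : (G.fill n).Spinc) : (j : G.Index n q) →
    (((pieceDiagram hneg q).obj j).space ⟶ ((diagram hneg (knotLattice G) q).obj j).space)
  | .a p => (hocolimSpaceMap (phiFun q (.a p)).monotone.functor (𝟙 _))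
  | .b p => (hocolimSpaceMap (phiFun q (.b p)).monotone.functor (𝟙 _))

end KnotGraph

end KnotLattice

open KnotLattice KnotLattice.KnotGraph

/-!
The face relation of cubes of `G.fill n` is controlled in the direction of `v₀` by the number `Â`,
because `Σ² < 0` by negative definiteness: a step along `v₀` changes `Â` by `Σ² ≠ 0`, and a step along
a vertex of `G` does not change it, `Σ` being orthogonal to `G` (`none_notMem_of_alexander`,
`none_mem_of_alexander`). Everything else follows from this.

*Pieces.* A characteristic class of `G.fill n` is determined by its restriction to `G` and its `Â`
(`char_ext`). Hence `[L, E] ↦ [L|_G, E \ {v₀}]` identifies the face poset of each piece with the one of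
the cubes of `G` over `t`, and `Φ` is bijective on simplices. It preserves heights because `L²` splits
along `Σ` and because the vertices of `[L, E]` with `v₀ ∈ E` are those of its front and of its back face
(`height_of_mem`, `height_of_notMem`). As `Â(L + u₀) = Â(L) + 1` and `L + u₀`, `L` have the same
restriction to `G`, the same formulas compute `h_U [L + u₀, E]`, so that both filtrations are treated at
once in `height_phi`.

*Assembling.* The index category is thin (`isThin_index`), a cube determines the index of its piece, and
a face relation between cubes gives a morphism between the indices; so a chain of cubes determines its
chain of indices. The maps between the pieces are bijective and reflect the face relation
(`push_injective`, `push_surjective`, `le_of_push_le`), so the chain of cubes of the first piece is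
determined as well. This is the bijectivity of the canonical map `fubini`.

*The dual knot.* The isomorphism with both filtrations is forced to be `fubini⁻¹` followed by
`hocolim Φ`. It respects the flip maps because `[L, E] ↦ [L + u₀, E]` acts on the pieces over the shift
`i ↦ i + 1` and becomes the identity after restriction to `G` (`push_shiftPiece`,
`hocolimNat_shiftSimplex`).
-/

/-! ### Isomorphisms of filtered simplicial sets and of spaces with flip map -/

namespace KnotLattice

open FiltSSet WeightedGraph

theorem isIso_of_bijective {X Y : SSet.{u}} (f : X ⟶ Y)
    (h : ∀ m, Function.Bijective (f.app m)) : IsIso f := by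
  rw [NatTrans.isIso_iff_isIso_app]
  exact fun m => (isIso_iff_bijective _).2 (h m)

/-- An isomorphism of the underlying simplicial sets which preserves heights is an isomorphism of
filtered simplicial sets. -/
theorem FiltSSet.isIso_of_base {P : Type} [Preorder P] {X Y : FiltSSet.{u} P} (f : X ⟶ Y)
    (hf : IsIso (Hom.base f))
    (h : ∀ {m : SimplexCategoryᵒᵖ} (x : X.space.obj m),
      Y.height ((Hom.base f).app m x) ≤ X.height x) : IsIso f := by
  refine ⟨⟨{ base := inv (Hom.base f), mono := fun {m} y => ?_ }, ?_, ?_⟩⟩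
  · have e : (Hom.base f).app m ((inv (Hom.base f)).app m y) = y := by
      rw [← comp_apply, ← NatTrans.comp_app, IsIso.inv_hom_id]; rfl
    conv_lhs => rw [← e]
    exact h _
  · exact hom_ext _ _ (IsIso.hom_inv_id _)
  · exact hom_ext _ _ (IsIso.inv_hom_id _)

theorem FiltSSet.isIso_base {P : Type} [Preorder P] {X Y : FiltSSet.{u} P} (f : X ⟶ Y)
    [IsIso f] : IsIso (Hom.base f) :=
  (inferInstance : IsIso (FiltSSet.forget.map f))

/-- Componentwise isomorphisms commuting with the flip maps form an isomorphism of doubly filtered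
spaces with flip map. -/
noncomputable def KnotSpace.isoOfComponents {V : Type u} [Fintype V] [DecidableEq V] {G : KnotGraph V}
    {X Y : KnotSpace G} (e : ∀ t, X.space t ≅ Y.space t)
    (h : ∀ t, p₂.map (e t).hom ≫ Y.flip t = X.flip t ≫ p₁.map (e (addKnot t)).hom) : X ≅ Y where
  hom := { app := fun t => (e t).hom, comm := h }
  inv :=
    { app := fun t => (e t).inv
      comm := fun t => by
        rw [← cancel_epi (p₂.map (e t).hom), ← Category.assoc, ← Functor.map_comp, Iso.hom_inv_id,
          CategoryTheory.Functor.map_id, Category.id_comp, ← Category.assoc, h, Category.assoc,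
          ← Functor.map_comp, Iso.hom_inv_id, CategoryTheory.Functor.map_id, Category.comp_id] }
  hom_inv_id := KnotSpace.Hom.ext (funext fun t => (e t).hom_inv_id)
  inv_hom_id := KnotSpace.Hom.ext (funext fun t => (e t).inv_hom_id)

section

variable {J J' : Type u}

theorem nerve_functor_bijective [Preorder J] [Preorder J'] (f : J →o J')
    (hf : Function.Bijective f) (hle : ∀ x y, f x ≤ f y → x ≤ y) (m : SimplexCategoryᵒᵖ) :
    Function.Bijective ((nerveMap f.monotone.functor).app m) := by
  constructor
  · intro s s' h
    refine nerve.ext_of_isThin (funext fun i => hf.1 ?_)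
    exact congrArg (fun t : (nerve J').obj m => t.obj i) h
  · intro s
    choose g hg using hf.2
    refine ⟨Monotone.functor (f := fun i => g (s.obj i)) fun i j h => hle _ _ ?_,
      nerve.ext_of_isThin (funext fun i => hg (s.obj i))⟩
    rw [hg, hg]
    exact leOfHom (s.map (homOfLE h))

theorem hocolimSpaceMap_bijective [SmallCategory J] [SmallCategory J'] {F : J ⥤ SSet.{u}}
    {F' : J' ⥤ SSet.{u}} (S : J ⥤ J') (α : F ⟶ S ⋙ F') (m : SimplexCategoryᵒᵖ)
    (hS : Function.Bijective ((nerveMap S).app m))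
    (hα : ∀ j, Function.Bijective ((α.app j).app m)) :
    Function.Bijective ((hocolimSpaceMap S α).app m) := by
  constructor
  · rintro ⟨c, x⟩ ⟨c', x'⟩ h
    have hc : c = c' := hS.1 (congrArg Sigma.fst h)
    subst hc
    refine Sigma.ext rfl (heq_of_eq ((hα _).1 ?_))
    exact eq_of_heq (Sigma.ext_iff.1 h).2
  · rintro ⟨c, x⟩
    obtain ⟨c, rfl⟩ := hS.2 c
    obtain ⟨x, rfl⟩ := (hα _).2 x
    exact ⟨⟨c, x⟩, rfl⟩

/-- An isomorphism of posets and a bijective transformation induce an isomorphism. -/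
theorem isIso_hocolimSpaceMap_functor [Preorder J] [Preorder J'] {F : J ⥤ SSet.{u}}
    {F' : J' ⥤ SSet.{u}} (f : J →o J')
    (hf : Function.Bijective f) (hle : ∀ x y, f x ≤ f y → x ≤ y) (α : F ⟶ f.monotone.functor ⋙ F')
    (hα : ∀ j m, Function.Bijective ((α.app j).app m)) :
    IsIso (hocolimSpaceMap f.monotone.functor α) :=
  isIso_of_bijective _ fun m => hocolimSpaceMap_bijective _ _ _
    (nerve_functor_bijective f hf hle m) fun j => hα j m

theorem isIso_hocolimNat_base [SmallCategory J] {P : Type} [Preorder P] {F F' : J ⥤ FiltSSet.{u} P}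
    (α : F ⟶ F') [∀ j, IsIso (α.app j)] : IsIso (Hom.base (hocolimNat α)) := by
  refine isIso_of_bijective _ fun m => hocolimSpaceMap_bijective _ _ m ?_ fun j => ?_
  · exact Function.bijective_id
  · have := FiltSSet.isIso_base (α.app j)
    exact (isIso_iff_bijective _).1 (inferInstanceAs (IsIso ((Hom.base (α.app j)).app m)))

end

end KnotLattice

/-! ### Restriction of cubes to the old graph -/

namespace KnotLattice

open FiltSSet WeightedGraph

theorem WeightedGraph.Cube.height_le {V : Type u} [Fintype V] [DecidableEq V] {G : WeightedGraph V}
    (c : G.Cube) {I : Finset V} (hI : I ⊆ c.dirs) : c.height ≤ (c.char.add (ind I)).height :=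
  Finset.inf'_le (fun I => (c.char.add (ind I)).height) (Finset.mem_powerset.2 hI)

namespace KnotGraph

variable {V : Type u} [Fintype V] [DecidableEq V] {G : KnotGraph V} {n : ℤ}

theorem ind_of_none_notMem {I : Finset (Option V)} (h : none ∉ I) :
    ind I = extend (ind I.eraseNone) := by
  funext o; cases o <;> simp [ind, extend, h]

theorem ind_of_none_mem {I : Finset (Option V)} (h : none ∈ I) :
    ind I = core + extend (ind I.eraseNone) := by
  funext o; cases o <;> simp [ind, extend, core, h]

theorem height_add_ind_of_notMem (hneg : (G.fill n).NegDef) (L : (G.fill n).Char)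
    {I : Finset (Option V)} (h : none ∉ I) :
    (L.add (ind I)).height = ((restrict L).add (ind I.eraseNone)).height +
      gradingShift (G.sigmaSq n) (alexander L) := by
  rw [height_eq hneg, ind_of_none_notMem h, restrict_add_extend, alexander_add_extend hneg]

theorem height_add_ind_of_mem (hneg : (G.fill n).NegDef) (L : (G.fill n).Char)
    {I : Finset (Option V)} (h : none ∈ I) :
    (L.add (ind I)).height = ((addKnotChar (restrict L)).add (ind I.eraseNone)).height +
      2 * alexander L + gradingShift (G.sigmaSq n) (alexander L) := by
  rw [height_eq hneg, ind_of_none_mem h, ← Char.add_add, restrict_add_extend,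
    alexander_add_extend hneg, restrict_add_core, alexander_add_core hneg,
    gradingShift_add (sigmaSq_neg hneg).ne]
  ring

/-- The cube `[L|_G, E \ {v₀}]` of a cube `[L, E]`. -/
def restrictCube (c : (G.fill n).Cube) : G.Cube := ⟨restrict c.char, c.dirs.eraseNone⟩

theorem height_of_notMem (hneg : (G.fill n).NegDef) (c : (G.fill n).Cube) (h : none ∉ c.dirs) :
    c.height = (restrictCube c).height + gradingShift (G.sigmaSq n) (alexander c.char) := by
  refine le_antisymm ?_ ?_
  · obtain ⟨I, hI, e⟩ := (restrictCube c).exists_height_eq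
    have := c.height_le (I := I.map Function.Embedding.some) fun o ho => by
      obtain ⟨v, hv, rfl⟩ := Finset.mem_map.1 ho
      exact Finset.mem_eraseNone.1 (hI hv)
    rwa [height_add_ind_of_notMem hneg _ (by simp), Finset.eraseNone_map_some,
      show ((restrict c.char).add (ind I)).height = _ from e.symm] at this
  · obtain ⟨I, hI, e⟩ := c.exists_height_eq
    rw [e, height_add_ind_of_notMem hneg _ fun h' => h (hI h')]
    gcongr
    exact (restrictCube c).height_le (Finset.eraseNone.monotone hI)

/-- The vertices of a cube `[L, E]` with `v₀ ∈ E` are those of its front and of its back face in the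
direction of `v₀`; the minima of the heights over these faces are the two entries of `min`. -/
theorem height_of_mem (hneg : (G.fill n).NegDef) (c : (G.fill n).Cube) (h : none ∈ c.dirs) :
    c.height = min (restrictCube c).height
      ((addKnotCube (restrictCube c)).height + 2 * alexander c.char) +
        gradingShift (G.sigmaSq n) (alexander c.char) := by
  refine le_antisymm ?_ ?_
  · rw [← sub_le_iff_le_add, le_min_iff, sub_le_iff_le_add, sub_le_iff_le_add]
    constructor
    · obtain ⟨I, hI, e⟩ := (restrictCube c).exists_height_eq
      have := c.height_le (I := I.map Function.Embedding.some) fun o ho => by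
        obtain ⟨v, hv, rfl⟩ := Finset.mem_map.1 ho
        exact Finset.mem_eraseNone.1 (hI hv)
      rwa [height_add_ind_of_notMem hneg _ (by simp), Finset.eraseNone_map_some,
        show ((restrict c.char).add (ind I)).height = _ from e.symm] at this
    · obtain ⟨I, hI, e⟩ := (addKnotCube (restrictCube c)).exists_height_eq
      have := c.height_le (I := I.insertNone) fun o ho => by
        cases o with
        | none => exact h
        | some v => exact Finset.mem_eraseNone.1 (hI (Finset.some_mem_insertNone.1 ho))
      rwa [height_add_ind_of_mem hneg _ (by simp), Finset.eraseNone_insertNone,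
        show ((addKnotChar (restrict c.char)).add (ind I)).height = _ from e.symm] at this
  · obtain ⟨I, hI, e⟩ := c.exists_height_eq
    have hI' := Finset.eraseNone.monotone hI
    rw [e]
    by_cases hn : none ∈ I
    · rw [height_add_ind_of_mem hneg _ hn]
      gcongr
      refine (min_le_right _ _).trans ?_
      gcongr
      exact (addKnotCube (restrictCube c)).height_le hI'
    · rw [height_add_ind_of_notMem hneg _ hn]
      gcongr
      exact (min_le_left _ _).trans ((restrictCube c).height_le hI')

theorem restrictCube_addKnotCube (c : (G.fill n).Cube) :
    restrictCube (addKnotCube (G := G.dual n) c) = restrictCube c :=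
  Cube.ext (restrict_addKnot_dual c.char) rfl

/-- A characteristic class is determined by its restriction and its `Â`. -/
theorem char_ext {L L' : (G.fill n).Char} (h : restrict L = restrict L')
    (h' : alexander L = alexander L') : L = L' := by
  unfold alexander at h'
  rw [evalSigma_eq, evalSigma_eq, h] at h'
  have h0 : L.toRat none = L'.toRat none := by linarith
  apply Subtype.ext
  funext o
  cases o with
  | none => exact Int.cast_injective h0
  | some v => exact congrFun (congrArg Subtype.val h) v

/-- The value of `Â` detects a step in the direction of `v₀`. -/
theorem none_notMem_of_alexander (hneg : (G.fill n).NegDef) {L : (G.fill n).Char}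
    {J : Finset (Option V)} (h : alexander (L.add (ind J)) = alexander L) : none ∉ J := by
  intro hJ
  rw [alexander_add hneg] at h
  simp [ind, hJ, (sigmaSq_neg hneg).ne] at h

theorem none_mem_of_alexander (hneg : (G.fill n).NegDef) {L : (G.fill n).Char}
    {J : Finset (Option V)} (h : alexander (L.add (ind J)) = alexander L + G.sigmaSq n) :
    none ∈ J := by
  by_contra hJ
  rw [alexander_add hneg] at h
  simp only [ind, hJ, if_false, Int.cast_zero, zero_mul, add_zero] at h
  linarith [sigmaSq_neg hneg]

/-! ### The pieces and the cubes of the old graph -/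

variable {q : (G.fill n).Spinc}

theorem Piece.dirs_eq {j : G.Index n q} {c c' : Piece q j}
    (h : c.1.dirs.eraseNone = c'.1.dirs.eraseNone) : c.1.dirs = c'.1.dirs := by
  ext o
  cases o with
  | none => rw [c.2.2.2.2, c'.2.2.2.2]
  | some v => rw [← Finset.mem_eraseNone, h, Finset.mem_eraseNone]

theorem phiFun_injective (j : G.Index n q) : Function.Injective (phiFun q j) := by
  intro c c' h
  have h1 : restrictCube c.1 = restrictCube c'.1 := congrArg Subtype.val h
  refine Subtype.ext (Cube.ext (char_ext (congrArg Cube.char h1) ?_)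
    (Piece.dirs_eq (congrArg Cube.dirs h1)))
  rw [c.2.2.2.1, c'.2.2.2.1]

theorem phiFun_surjective (hneg : (G.fill n).NegDef) (j : G.Index n q) :
    Function.Surjective (phiFun q j) := by
  rintro ⟨⟨K, E⟩, hK⟩
  obtain ⟨L, rfl, hL, hi⟩ := j.point.mem
  obtain ⟨x, rfl⟩ := Char.spinc_eq_iff.1 ((hK.trans hL).symm)
  have hr := restrict_add_extend L x
  have ha := alexander_add_extend hneg L x
  cases j with
  | a p =>
    refine ⟨⟨⟨L.add (extend x), E.insertNone⟩, Char.spinc_add _ _, ?_, ha.trans hi.symm, ?_⟩, ?_⟩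
    · rw [hr]; exact hK
    · simp [Index.OnA]
    · exact Subtype.ext (Cube.ext hr (Finset.eraseNone_insertNone E))
  | b p =>
    refine ⟨⟨⟨L.add (extend x), E.map Function.Embedding.some⟩, Char.spinc_add _ _, ?_,
      ha.trans hi.symm, ?_⟩, ?_⟩
    · rw [hr]; exact hK
    · simp [Index.OnA]
    · exact Subtype.ext (Cube.ext hr (Finset.eraseNone_map_some E))

theorem le_of_phiFun_le (hneg : (G.fill n).NegDef) {j : G.Index n q} {c c' : Piece q j}
    (h : phiFun q j c ≤ phiFun q j c') : c ≤ c' := by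
  obtain ⟨hd, J, hJ, e⟩ := h
  refine ⟨fun o ho => ?_, J.map Function.Embedding.some, fun o ho => ?_, char_ext ?_ ?_⟩
  · cases o with
    | none => exact c.2.2.2.2.2 (c'.2.2.2.2.1 ho)
    | some v => exact Finset.mem_eraseNone.1 (hd (Finset.mem_eraseNone.2 ho))
  · obtain ⟨v, hv, rfl⟩ := Finset.mem_map.1 ho
    have := Finset.mem_sdiff.1 (hJ hv)
    exact Finset.mem_sdiff.2 ⟨Finset.mem_eraseNone.1 this.1,
      fun h' => this.2 (Finset.mem_eraseNone.2 h')⟩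
  · rw [ind_of_none_notMem (by simp), restrict_add_extend, Finset.eraseNone_map_some]
    exact e
  · rw [ind_of_none_notMem (by simp), alexander_add_extend hneg, c.2.2.2.1, c'.2.2.2.1]

theorem isIso_phi (hneg : (G.fill n).NegDef) (j : G.Index n q) : IsIso (phi hneg q j) := by
  have h1 := And.intro (phiFun_injective j) (phiFun_surjective hneg j)
  have h2 := fun c c' => le_of_phiFun_le hneg (j := j) (c := c) (c' := c')
  cases j with
  | a p => exact isIso_hocolimSpaceMap_functor _ h1 h2 _ fun _ _ => Function.bijective_id
  | b p => exact isIso_hocolimSpaceMap_functor _ h1 h2 _ fun _ _ => Function.bijective_id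

/-- On cubes, `Φ` preserves the heights of the dual knot diagram: the first height of the image of
`[L, E]` is `h_U [L, E]`, the second one is `h_U [L + u₀, E]`. -/
theorem height_phi (hneg : (G.fill n).NegDef) (j : G.Index n q) {m : SimplexCategoryᵒᵖ}
    (x : (hocolim (points (Piece.height q j))).space.obj m) :
    (doubleObj (knotLattice G) q j).height ((phi hneg q j).app m x) =
      ((x.1.obj 0).1.height, (addKnotCube (G := G.dual n) (x.1.obj 0).1).height) := by
  generalize hc : x.1.obj 0 = c
  have hi : alexander (addKnotCube (G := G.dual n) c.1).char = j.point.alex + 1 :=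
    (alexander_addKnot_dual c.1.char).trans (by rw [c.2.2.2.1])
  cases j with
  | a p =>
    have h := c.2.2.2.2.2 trivial
    rw [height_of_mem hneg _ h, height_of_mem (c := addKnotCube (G := G.dual n) c.1) hneg h,
      restrictCube_addKnotCube, hi, c.2.2.2.1, ← hc]
    rfl
  | b p =>
    have h := fun h => c.2.2.2.2.1 h
    rw [height_of_notMem hneg _ h, height_of_notMem (c := addKnotCube (G := G.dual n) c.1) hneg h,
      restrictCube_addKnotCube, hi, c.2.2.2.1, ← hc]
    rfl

/-- The transformation `Φ` with components `phi`, for the first filtration. -/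
noncomputable def phiHom (hneg : (G.fill n).NegDef) (q : (G.fill n).Spinc) :
    pieceDiagram hneg q ⟶ diagram hneg (knotLattice G) q where
  app j :=
    { base := phi hneg q j
      mono := fun x => (congrArg Prod.fst (height_phi hneg j x)).ge }
  naturality j j' f := by
    apply FiltSSet.hom_ext
    change Index.Hom G n q j j' at f
    ext m x
    obtain ⟨s, y⟩ := x
    cases f with
    | id j => rfl
    | lam p =>
      refine Sigma.ext (nerve.ext_of_isThin (funext fun i => Subtype.ext (Cube.ext rfl ?_))) HEq.rfl
      change (Finset.erase _ none).eraseNone = Finset.eraseNone _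
      ext v; simp
    | rho p i' h mem =>
      refine Sigma.ext (nerve.ext_of_isThin (funext fun i => Subtype.ext (Cube.ext ?_ ?_))) HEq.rfl
      · exact restrict_add_core _
      · change (Finset.erase _ none).eraseNone = Finset.eraseNone _
        ext v; simp

theorem isIso_phiHom (hneg : (G.fill n).NegDef) (q : (G.fill n).Spinc) :
    IsIso (phiHom hneg q) := by
  rw [NatTrans.isIso_iff_isIso_app]
  exact fun j => FiltSSet.isIso_of_base _ (isIso_phi hneg j)
    fun x => (congrArg Prod.fst (height_phi hneg j x)).le

end KnotGraph
end KnotLattice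

/-! ### Chains of cubes and chains of indices -/

namespace KnotLattice

open FiltSSet WeightedGraph

namespace KnotGraph

variable {V : Type u} [Fintype V] [DecidableEq V] {G : KnotGraph V} {n : ℤ} {q : (G.fill n).Spinc}

/-- There is at most one morphism between two objects of the index category: `λ` and `ρ` have
different targets since `Σ² ≠ 0`. -/
theorem isThin_index (hneg : (G.fill n).NegDef) (q : (G.fill n).Spinc) :
    Quiver.IsThin (G.Index n q) := by
  have hr := (sigmaSq_neg hneg).ne
  intro j j'
  refine ⟨fun f g => ?_⟩
  change Index.Hom G n q j j' at f g
  cases j with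
  | b p => cases f; cases g; rfl
  | a p =>
    cases j' with
    | a p' => cases f; cases g; rfl
    | b p' =>
      obtain ⟨t, i, hp⟩ := p
      obtain ⟨t', i', hp'⟩ := p'
      have key : ∀ f : Index.Hom G n q (.a ⟨t, i, hp⟩) (.b ⟨t', i', hp'⟩),
          (i' = i ∧ HEq f (Index.Hom.lam (⟨t, i, hp⟩ : G.SpincW n q))) ∨
            (∃ (h : i' = i + G.sigmaSq n) (m : ∃ L : (G.fill n).Char,
                L.spinc = q ∧ addKnot t = (restrict L).spinc ∧ i' = alexander L),
              HEq f (Index.Hom.rho (⟨t, i, hp⟩ : G.SpincW n q) i' h m)) := by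
        intro f
        cases f with
        | lam => exact Or.inl ⟨rfl, HEq.rfl⟩
        | rho _ _ h m => exact Or.inr ⟨h, m, HEq.rfl⟩
      rcases key f with ⟨h1, h2⟩ | ⟨h1, m1, h2⟩ <;> rcases key g with ⟨h3, h4⟩ | ⟨h3, m3, h4⟩
      · exact eq_of_heq (h2.trans h4.symm)
      · exact absurd (by linarith) hr
      · exact absurd (by linarith) hr
      · exact eq_of_heq (h2.trans h4.symm)

theorem Index.ext_of_point {j j' : G.Index n q} (h : j.point = j'.point)
    (h' : j.OnA ↔ j'.OnA) : j = j' := by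
  cases j <;> cases j' <;> simp_all [Index.point, Index.OnA]

theorem index_eq_of_mem {j j' : G.Index n q} {c : Piece q j} {c' : Piece q j'} (h : c.1 = c'.1) :
    j = j' := by
  obtain ⟨c, hc⟩ := c
  obtain ⟨c', hc'⟩ := c'
  obtain rfl : c = c' := h
  refine Index.ext_of_point (SpincW.ext (hc.2.1.symm.trans hc'.2.1)
    (hc.2.2.1.symm.trans hc'.2.2.1)) (hc.2.2.2.symm.trans hc'.2.2.2)

open scoped Classical in
/-- The object of the index category whose piece contains a given cube. -/
noncomputable def indexOf (e : (G.fill n).CubeOver q) : G.Index n q :=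
  if none ∈ e.1.dirs then .a ⟨_, _, e.1.char, e.2, rfl, rfl⟩
  else .b ⟨_, _, e.1.char, e.2, rfl, rfl⟩

/-- A cube as an element of its piece. -/
noncomputable def toPiece (e : (G.fill n).CubeOver q) : Piece q (indexOf e) :=
  ⟨e.1, e.2, by
    unfold indexOf
    split_ifs with h <;> simp [Index.point, Index.OnA, h]⟩

theorem nonempty_hom_of_le (hneg : (G.fill n).NegDef) {j j' : G.Index n q} (c : Piece q j)
    (c' : Piece q j') (h : c.1 ≤ c'.1) : Nonempty (j ⟶ j') := by
  obtain ⟨hd, J, hJ, e⟩ := h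
  have h1 := c.2.2.1
  have h2 := c.2.2.2.1
  have h1' := c'.2.2.1
  have h2' := c'.2.2.2.1
  have hsame : none ∉ J → j.point = j'.point := fun hn => by
    rw [e, ind_of_none_notMem hn] at h1' h2'
    rw [restrict_add_extend, Char.spinc_add] at h1'
    rw [alexander_add_extend hneg] at h2'
    exact SpincW.ext (h1.symm.trans h1') (h2.symm.trans h2')
  cases j with
  | b p =>
    have hn : none ∉ J := fun hn => c.2.2.2.2.1 (Finset.mem_sdiff.1 (hJ hn)).1
    cases j' with
    | a p' => exact (c.2.2.2.2.1 (hd (c'.2.2.2.2.2 trivial))).elim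
    | b p' =>
      obtain rfl : p = p' := hsame hn
      exact ⟨𝟙 _⟩
  | a p =>
    cases j' with
    | a p' =>
      have hn : none ∉ J := fun hn => (Finset.mem_sdiff.1 (hJ hn)).2 (c'.2.2.2.2.2 trivial)
      obtain rfl : p = p' := hsame hn
      exact ⟨𝟙 _⟩
    | b p' =>
      by_cases hn : none ∈ J
      · rw [e, ind_of_none_mem hn, ← Char.add_add] at h1' h2'
        rw [restrict_add_extend, Char.spinc_add, restrict_add_core, ← addKnot_spinc, h1] at h1'
        rw [alexander_add_extend hneg, alexander_add_core hneg, h2] at h2'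
        obtain ⟨t', i', hp'⟩ := p'
        obtain rfl : addKnot p.spinc = t' := h1'
        exact ⟨Index.Hom.rho p i' h2'.symm hp'⟩
      · obtain rfl : p = p' := hsame hn
        exact ⟨Index.Hom.lam p⟩

/-- The functor sending a cube over `q` to the index of its piece. -/
noncomputable def indexFunctor (hneg : (G.fill n).NegDef) (q : (G.fill n).Spinc) :
    (G.fill n).CubeOver q ⥤ G.Index n q where
  obj := indexOf
  map {e e'} f := (nonempty_hom_of_le hneg (toPiece e) (toPiece e') (leOfHom f)).some
  map_id _ := (isThin_index hneg q _ _).elim _ _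
  map_comp _ _ := (isThin_index hneg q _ _).elim _ _

/-- A cube with `v₀ ∈ E` is determined by either of its faces in the direction of `v₀`. -/
theorem push_injective (hneg : (G.fill n).NegDef) {j j' : G.Index n q} (f : j ⟶ j') :
    Function.Injective (push hneg f) := by
  intro c c' h
  have h0 := congrArg Subtype.val h
  change Index.Hom G n q j j' at f
  cases f with
  | id => exact h
  | lam p =>
    have h1 : c.1.char = c'.1.char := congrArg (fun e => e.char) h0
    have h2 : c.1.dirs.erase none = c'.1.dirs.erase none := congrArg (fun e => e.dirs) h0
    refine Subtype.ext (Cube.ext h1 (Piece.dirs_eq ?_))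
    ext v
    simpa using Finset.ext_iff.1 h2 (some v)
  | rho p i' hi mem =>
    have h1 : c.1.char.add core = c'.1.char.add core := congrArg Cube.char h0
    have h2 : c.1.dirs.erase none = c'.1.dirs.erase none := congrArg Cube.dirs h0
    refine Subtype.ext (Cube.ext ?_ (Piece.dirs_eq ?_))
    · have := congrArg (fun L => Char.add L (-core)) h1
      simpa only [Char.add_add, add_neg_cancel, Char.add_zero] using this
    · ext v
      simpa using Finset.ext_iff.1 h2 (some v)

theorem push_surjective (hneg : (G.fill n).NegDef) {j j' : G.Index n q} (f : j ⟶ j') :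
    Function.Surjective (push hneg f) := by
  intro c
  change Index.Hom G n q j j' at f
  cases f with
  | id => exact ⟨c, rfl⟩
  | lam p =>
    have hn : none ∉ c.1.dirs := fun h => c.2.2.2.2.1 h
    exact ⟨⟨⟨c.1.char, insert none c.1.dirs⟩, c.2.1, c.2.2.1, c.2.2.2.1, by simp [Index.OnA]⟩,
      Subtype.ext (Cube.ext rfl (Finset.erase_insert hn))⟩
  | rho p i' hi mem =>
    -- A class `L` over the source, moved along `G` until its back face is `c`.
    obtain ⟨L, hL, hs, ha⟩ := p.mem
    obtain ⟨x, hx⟩ := Char.spinc_eq_iff.1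
      (show (addKnotChar (restrict L)).spinc = (restrict c.1.char).spinc from
        (congrArg addKnot hs.symm).trans c.2.2.1.symm)
    have hc : c.1.char = (L.add (extend x)).add core := by
      refine char_ext ?_ ?_
      · rw [hx, restrict_add_core, restrict_add_extend, addKnotChar_add]
      · rw [alexander_add_core hneg, alexander_add_extend hneg, ← ha, c.2.2.2.1]
        exact hi
    have hn : none ∉ c.1.dirs := fun h => c.2.2.2.2.1 h
    refine ⟨⟨⟨L.add (extend x), insert none c.1.dirs⟩, (Char.spinc_add _ _).trans hL, ?_, ?_,
      by simp [Index.OnA]⟩, Subtype.ext (Cube.ext hc.symm (Finset.erase_insert hn))⟩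
    · rw [restrict_add_extend, Char.spinc_add]; exact hs.symm
    · rw [alexander_add_extend hneg]; exact ha.symm

theorem Piece.le_of_none_notMem {j : G.Index n q} {c c' : Piece q j}
    (hd : ∀ v, some v ∈ c'.1.dirs → some v ∈ c.1.dirs) {J : Finset (Option V)} (hn : none ∉ J)
    (hJ : ∀ v, some v ∈ J → some v ∈ c.1.dirs ∧ some v ∉ c'.1.dirs)
    (e : c'.1.char = c.1.char.add (ind J)) : c ≤ c' := by
  refine ⟨fun o ho => ?_, J, fun o ho => Finset.mem_sdiff.2 ?_, e⟩
  · cases o with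
    | none => exact c.2.2.2.2.2 (c'.2.2.2.2.1 ho)
    | some v => exact hd v ho
  · cases o with
    | none => exact (hn ho).elim
    | some v => exact hJ v ho

theorem add_core_cancel {L L' : (G.fill n).Char} (x : Option V → ℤ)
    (h : L'.add core = L.add (core + x)) : L' = L.add x := by
  have := congrArg (fun L => Char.add L (-core)) h
  simp only [Char.add_add, add_neg_cancel, Char.add_zero] at this
  rw [this]
  congr 1
  abel

/-- The maps between pieces reflect the face relation, also when the two cubes are pushed to
consecutive pieces: whether the step between the images runs along `v₀` is read off from `Â`. -/
theorem le_of_push_le (hneg : (G.fill n).NegDef) {j j' j'' : G.Index n q} (f : j ⟶ j')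
    (g : j' ⟶ j'') {c c' : Piece q j} (h : (push hneg f c).1 ≤ (push hneg (f ≫ g) c').1) :
    c ≤ c' := by
  change Index.Hom G n q j j' at f
  change Index.Hom G n q j' j'' at g
  obtain ⟨hd, J, hJ, e⟩ := h
  cases f with
  | id j =>
    cases g with
    | id => exact ⟨hd, J, hJ, e⟩
    | lam p =>
      change c'.1.char = c.1.char.add (ind J) at e
      change c'.1.dirs.erase none ⊆ c.1.dirs at hd
      change J ⊆ c.1.dirs \ c'.1.dirs.erase none at hJ
      refine Piece.le_of_none_notMem (fun v hv => hd (by simpa using hv))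
        (none_notMem_of_alexander hneg (L := c.1.char) ?_) (fun v hv => by simpa using hJ hv) e
      rw [← e, c.2.2.2.1, c'.2.2.2.1]
    | rho p i' hi mem =>
      -- The step from `c` to the back face of `c'` runs along `v₀`; `c'` itself is reached without it.
      change c'.1.char.add core = c.1.char.add (ind J) at e
      change c'.1.dirs.erase none ⊆ c.1.dirs at hd
      change J ⊆ c.1.dirs \ c'.1.dirs.erase none at hJ
      have hn : none ∈ J := by
        refine none_mem_of_alexander hneg (L := c.1.char) ?_
        rw [← e, alexander_add_core hneg, c.2.2.2.1, c'.2.2.2.1]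
      have hJ' : (J.erase none).eraseNone = J.eraseNone := by ext v; simp
      refine Piece.le_of_none_notMem (J := J.erase none) (fun v hv => hd (by simpa using hv))
        (by simp) (fun v hv => by simpa using hJ (Finset.mem_of_mem_erase hv)) ?_
      rw [ind_of_none_notMem (I := J.erase none) (by simp), hJ']
      exact add_core_cancel _ (by rw [e, ← ind_of_none_mem hn])
  | lam p =>
    cases g with
    | id =>
      change c'.1.char = c.1.char.add (ind J) at e
      change c'.1.dirs.erase none ⊆ c.1.dirs.erase none at hd
      change J ⊆ c.1.dirs.erase none \ c'.1.dirs.erase none at hJ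
      exact Piece.le_of_none_notMem (fun v hv => by simpa using @hd (some v) (by simpa using hv))
        (fun h => by simpa using hJ h) (fun v hv => by simpa using hJ hv) e
  | rho p i' hi mem =>
    cases g with
    | id =>
      change c'.1.char.add core = (c.1.char.add core).add (ind J) at e
      change c'.1.dirs.erase none ⊆ c.1.dirs.erase none at hd
      change J ⊆ c.1.dirs.erase none \ c'.1.dirs.erase none at hJ
      exact Piece.le_of_none_notMem (fun v hv => by simpa using @hd (some v) (by simpa using hv))
        (fun h => by simpa using hJ h) (fun v hv => by simpa using hJ hv)
        (add_core_cancel _ (by rw [e, Char.add_add]))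

/-- A simplex of the homotopy colimit of the pieces is recovered from its chain of cubes: the
chain of indices by `indexFunctor`, the cubes of the first piece by the bijectivity of `push`. -/
theorem fubini_bijective (hneg : (G.fill n).NegDef) (q : (G.fill n).Spinc) (m : SimplexCategoryᵒᵖ) :
    Function.Bijective ((Hom.base (fubini hneg q)).app m) := by
  have := isThin_index hneg q
  constructor
  · rintro ⟨c, s, y⟩ ⟨c', s', y'⟩ h
    have hk : ∀ k, (push hneg (c.map (homOfLE (Fin.zero_le k))) (s.obj k)).1 =
        (push hneg (c'.map (homOfLE (Fin.zero_le k))) (s'.obj k)).1 := fun k =>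
      congrArg (fun z : ((G.fill n).lattice q).space.obj m => (z.1.obj k).1) h
    obtain rfl : c = c' := nerve.ext_of_isThin (funext fun k => index_eq_of_mem (hk k))
    obtain rfl : s = s' := nerve.ext_of_isThin (funext fun k =>
      push_injective hneg _ (Subtype.ext (hk k)))
    rfl
  · rintro ⟨e, y⟩
    let c : (nerve (G.Index n q)).obj m := (nerveMap (indexFunctor hneg q)).app m e
    choose s hs using fun k => push_surjective hneg (c.map (homOfLE (Fin.zero_le k)))
      (toPiece (e.obj k))
    have hmono : Monotone s := fun k l h => by
      refine le_of_push_le hneg (c.map (homOfLE (Fin.zero_le k))) (c.map (homOfLE h)) ?_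
      rw [← c.map_comp, hs k]
      change _ ≤ (push hneg (c.map (homOfLE (Fin.zero_le l))) (s l)).1
      rw [hs l]
      exact leOfHom (e.map (homOfLE h))
    refine ⟨⟨c, hmono.functor, PUnit.unit⟩,
      Sigma.ext (nerve.ext_of_isThin (funext fun k => Subtype.ext ?_)) HEq.rfl⟩
    have hk := congrArg Subtype.val (hs k)
    exact hk

theorem isIso_fubini_base (hneg : (G.fill n).NegDef) (q : (G.fill n).Spinc) :
    IsIso (Hom.base (fubini hneg q)) :=
  isIso_of_bijective _ (fubini_bijective hneg q)

/-- The first cube of the chain assembled from a simplex is the first cube of that simplex. -/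
theorem fubiniChain_zero (hneg : (G.fill n).NegDef) {k : ℕ}
    (c : ComposableArrows (G.Index n q) k) (s : ComposableArrows (Piece q (c.obj 0)) k) :
    ((fubiniChain hneg c s).obj 0).1 = (s.obj 0).1 := by
  have h : c.map (homOfLE (Fin.zero_le 0)) = 𝟙 _ := c.map_id 0
  change (push hneg (c.map (homOfLE (Fin.zero_le 0))) (s.obj 0)).1 = _
  rw [h]
  rfl

theorem isIso_fubini (hneg : (G.fill n).NegDef) (q : (G.fill n).Spinc) :
    IsIso (fubini hneg q) := by
  refine FiltSSet.isIso_of_base _ (isIso_fubini_base hneg q) ?_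
  rintro m ⟨c, s, y⟩
  exact (congrArg Cube.height (fubiniChain_zero hneg c s)).le

end KnotGraph
end KnotLattice

/-! ### The second filtration and the flip map -/

namespace KnotLattice

open FiltSSet WeightedGraph

namespace KnotGraph

variable {V : Type u} [Fintype V] [DecidableEq V] {G : KnotGraph V} {n : ℤ} {q : (G.fill n).Spinc}

/-- The heights of corresponding simplices of the lattice space of the dual knot and of the dual
knot surgery agree. -/
theorem height_fubini (hneg : (G.fill n).NegDef) (q : (G.fill n).Spinc) {m : SimplexCategoryᵒᵖ}
    (z : (hocolim (pieceDiagram hneg q)).space.obj m) :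
    (((surgery hneg (knotLattice G)).space q).height
        ((Hom.base (hocolimNat (phiHom hneg q))).app m z) : ℚ × ℚ) =
      ((knotLattice (G.dual n)).space q).height ((Hom.base (fubini hneg q)).app m z) := by
  obtain ⟨c, x⟩ := z
  refine (height_phi hneg (c.obj 0) x).trans ?_
  have h := fubiniChain_zero hneg c x.1
  refine Prod.ext (congrArg Cube.height h).symm ?_
  exact (congrArg (fun c => (addKnotCube (G := G.dual n) c).height) h).symm

/-- The map `hocolim Φ` read on the lattice space through `fubini`, with both filtrations. -/
noncomputable def psi (hneg : (G.fill n).NegDef) (q : (G.fill n).Spinc) :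
    (knotLattice (G.dual n)).space q ⟶ (surgery hneg (knotLattice G)).space q :=
  haveI := isIso_fubini_base hneg q
  { base := (inv (Hom.base (fubini hneg q)) ≫ Hom.base (hocolimNat (phiHom hneg q)) :)
    mono := fun {m} x => by
      obtain ⟨z, rfl⟩ := (fubini_bijective hneg q m).2 x
      have e : (inv (Hom.base (fubini hneg q)) ≫ Hom.base (hocolimNat (phiHom hneg q))).app m
          ((Hom.base (fubini hneg q)).app m z) = (Hom.base (hocolimNat (phiHom hneg q))).app m z :=
        ConcreteCategory.congr_hom (NatTrans.congr_app
          (IsIso.hom_inv_id_assoc (Hom.base (fubini hneg q))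
            (Hom.base (hocolimNat (phiHom hneg q)))) m) z
      refine ge_of_eq ?_
      exact (congrArg ((surgery hneg (knotLattice G)).space q).height e).trans
        (height_fubini hneg q z) }

theorem fubini_comp_psi (hneg : (G.fill n).NegDef) (q : (G.fill n).Spinc) :
    fubini hneg q ≫ p₁.map (psi hneg q) = hocolimNat (phiHom hneg q) := by
  have := isIso_fubini_base hneg q
  exact FiltSSet.hom_ext _ _ (IsIso.hom_inv_id_assoc (Hom.base (fubini hneg q)) _)

theorem psi_app_fubini (hneg : (G.fill n).NegDef) (q : (G.fill n).Spinc) {m : SimplexCategoryᵒᵖ}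
    (z : (hocolim (pieceDiagram hneg q)).space.obj m) :
    (Hom.base (psi hneg q)).app m ((Hom.base (fubini hneg q)).app m z) =
      (Hom.base (hocolimNat (phiHom hneg q))).app m z :=
  congrArg (fun f => (Hom.base f).app m z) (fubini_comp_psi hneg q)

theorem isIso_psi (hneg : (G.fill n).NegDef) (q : (G.fill n).Spinc) : IsIso (psi hneg q) := by
  have := isIso_fubini_base hneg q
  have := isIso_phiHom hneg q
  have := isIso_hocolimNat_base (phiHom hneg q)
  refine FiltSSet.isIso_of_base _ (IsIso.comp_isIso'
    (f := inv (Hom.base (fubini hneg q))) inferInstance this) fun {m} x => ?_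
  obtain ⟨z, rfl⟩ := (fubini_bijective hneg q m).2 x
  rw [psi_app_fubini]
  exact (height_fubini hneg q z).le

/-- The action `[L, E] ↦ [L + u₀, E]` of the dual knot on the pieces. -/
noncomputable def shiftPiece (q : (G.fill n).Spinc) (j : G.Index n q) :
    Piece q j →o Piece (addKnot (G := G.dual n) q) ((shiftIndex G n q).obj j) where
  toFun c := ⟨addKnotCube (G := G.dual n) c.1, congrArg (addKnot (G := G.dual n)) c.2.1, by
      have h := (congrArg Char.spinc (restrict_addKnot_dual c.1.char)).trans c.2.2.1
      cases j <;> exact h, by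
      have h := (alexander_addKnot_dual c.1.char).trans (congrArg (· + 1) c.2.2.2.1)
      cases j <;> exact h, by
      have h := c.2.2.2.2
      cases j <;> exact h⟩
  monotone' _ _ h := (addKnotCube (G := G.dual n)).monotone h

/-- The maps between the pieces commute with the action of the dual knot. -/
theorem push_shiftPiece (hneg : (G.fill n).NegDef) {j j' : G.Index n q} (f : j ⟶ j')
    (c : Piece q j) :
    (push hneg ((shiftIndex G n q).map f) (shiftPiece q j c)).1 =
      addKnotCube (G := G.dual n) (push hneg f c).1 := by
  change Index.Hom G n q j j' at f
  cases f with
  | id => rfl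
  | lam p => rfl
  | rho p i' hi mem => exact Cube.ext (addKnotChar_add (G := G.dual n) c.1.char core).symm rfl

/-- The action of the dual knot on the simplices of the homotopy colimit of the pieces. -/
noncomputable def shiftSimplex (hneg : (G.fill n).NegDef) (q : (G.fill n).Spinc)
    {m : SimplexCategoryᵒᵖ} (z : (hocolim (pieceDiagram hneg q)).space.obj m) :
    (hocolim (pieceDiagram hneg (addKnot (G := G.dual n) q))).space.obj m :=
  ⟨(nerveMap (shiftIndex G n q)).app m z.1,
    (nerveMap (shiftPiece q (z.1.obj 0)).monotone.functor).app m z.2.1, PUnit.unit⟩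

theorem fubini_shiftSimplex (hneg : (G.fill n).NegDef) (q : (G.fill n).Spinc)
    {m : SimplexCategoryᵒᵖ} (z : (hocolim (pieceDiagram hneg q)).space.obj m) :
    (Hom.base (fubini hneg (addKnot (G := G.dual n) q))).app m (shiftSimplex hneg q z) =
      (Hom.base ((knotLattice (G.dual n)).flip q)).app m ((Hom.base (fubini hneg q)).app m z) := by
  obtain ⟨c, s, y⟩ := z
  refine Sigma.ext (nerve.ext_of_isThin (funext fun k => Subtype.ext ?_)) HEq.rfl
  exact push_shiftPiece hneg _ _

/-- After `Φ`, the action of the dual knot only shifts the indices, since it does not change the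
restrictions of the cubes to `G`. -/
theorem hocolimNat_shiftSimplex (hneg : (G.fill n).NegDef) (q : (G.fill n).Spinc)
    {m : SimplexCategoryᵒᵖ} (z : (hocolim (pieceDiagram hneg q)).space.obj m) :
    (Hom.base (hocolimNat (phiHom hneg (addKnot (G := G.dual n) q)))).app m
        (shiftSimplex hneg q z) =
      (Hom.base ((surgery hneg (knotLattice G)).flip q)).app m
        ((Hom.base (hocolimNat (phiHom hneg q))).app m z) := by
  obtain ⟨c, s, y⟩ := z
  refine Sigma.ext rfl (heq_of_eq ?_)
  have key : ∀ (j : G.Index n q) (s : (nerve (Piece q j)).obj m),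
      (phi hneg (addKnot (G := G.dual n) q) ((shiftIndex G n q).obj j)).app m
        ⟨(nerveMap (shiftPiece q j).monotone.functor).app m s, PUnit.unit⟩ =
      (Hom.base ((flipDiagram hneg (knotLattice G) q).app j)).app m
        ((phi hneg q j).app m ⟨s, PUnit.unit⟩) := by
    intro j s
    cases j with
    | a p => exact Sigma.ext (nerve.ext_of_isThin (funext fun k =>
        Subtype.ext (restrictCube_addKnotCube (s.obj k).1))) HEq.rfl
    | b p => exact Sigma.ext (nerve.ext_of_isThin (funext fun k =>
        Subtype.ext (restrictCube_addKnotCube (s.obj k).1))) HEq.rfl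
  exact key (c.obj 0) s

theorem psi_flip (hneg : (G.fill n).NegDef) (q : (G.fill n).Spinc) :
    p₂.map (psi hneg q) ≫ (surgery hneg (knotLattice G)).flip q =
      (knotLattice (G.dual n)).flip q ≫ p₁.map (psi hneg (addKnot (G := G.dual n) q)) := by
  apply FiltSSet.hom_ext
  ext m x
  obtain ⟨z, rfl⟩ := (fubini_bijective hneg q m).2 x
  change (Hom.base ((surgery hneg (knotLattice G)).flip q)).app m
      ((Hom.base (psi hneg q)).app m _) =
    (Hom.base (psi hneg (addKnot (G := G.dual n) q))).app m
      ((Hom.base ((knotLattice (G.dual n)).flip q)).app m _)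
  rw [← fubini_shiftSimplex, psi_app_fubini, psi_app_fubini, hocolimNat_shiftSimplex]

end KnotGraph
end KnotLattice

theorem proposition6p2 {V : Type u} [Fintype V] [DecidableEq V] (G : KnotGraph V) (n : ℤ)
    (hforest : G.total.IsAcyclic) (hneg : (G.fill n).NegDef) :
    ∃ (Φ : ∀ q : (G.fill n).Spinc, pieceDiagram hneg q ≅ diagram hneg (knotLattice G) q)
      (Ψ : knotLattice (G.dual n) ≅ surgery hneg (knotLattice G)),
      (∀ (q : (G.fill n).Spinc) (j : G.Index n q), ((Φ q).hom.app j).base = phi hneg q j) ∧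
      (∀ q : (G.fill n).Spinc, IsIso (fubini hneg q)) ∧
      ∀ q : (G.fill n).Spinc,
        fubini hneg q ≫ p₁.map (Ψ.hom.app q) = hocolimNat (Φ q).hom := by
  have h1 := isIso_phiHom hneg
  have h2 := isIso_psi hneg
  exact ⟨fun q => asIso (phiHom hneg q),
    KnotSpace.isoOfComponents (fun q => asIso (psi hneg q)) (psi_flip hneg),
    fun _ _ => rfl, isIso_fubini hneg, fubini_comp_psi hneg⟩
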